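/- Consider a two-tier cellular network in the plane. Macro base stations (MBSs) and femto access points (FAPs) form independent homogeneous Poisson point processes of densities $\lambda_B>0$ and $\lambda_F>0$, with transmission powers $P_B,P_F>0$, and $\tilde P_F=P_F/P_B$. The path loss exponent is $\alpha>2$, and $\delta=2/\alpha$. There are $N\ge 1$ channels. Under co-channel allocation each FAP uses one of them chosen uniformly at random, so the co-channel FAPs have density $\tilde\lambda_F=\lambda_F/N$, and each MBS uses the typical channel with probability $\zeta_C\in(0,1]$ (the activity factor). All fading coefficients are exponential with unit mean, and all positions, channel choices, activities and fading coefficients are independent. A user at the origin is served by the closest MBS. Let $R_m,R_d$ be the distances to the closest and the second closest MBS. For fixed $R\in(0,1)$ the user is a cell-edge user if $R_m/R_d>R$. When the serving MBS is at distance $r$, the signal-to-interference ratio is $\gamma(r)=h_0r^{-\alpha}/(I_e(r)+I_f)$, where $I_e(r)=\sum_i h_i\|x_i\|^{-\alpha}$ over the interfering co-channel MBSs and $I_f=\sum_j g_j\|y_j\|^{-\alpha}\tilde P_F$ over the co-channel FAPs. The co-channel MBSs that interfere with a cell-edge user are modelled as follows. With probability $\zeta_C$ (the second closest MBS is co-channel)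 they form the Poisson process of MBSs thinned by $\zeta_C$, restricted to $\{\|x\|\ge r\}$ and conditioned to have at least one point with $r\le\|x\|\le r/R$; with probability $1-\zeta_C$ they form the same thinned process restricted to $\{\|x\|\ge r\}$, without conditioning. The coverage probability $\mathcal C_{CE}(\beta)$ of a cell-edge user is the probability that the signal-to-interference ratio exceeds $\beta>0$, averaged over the law of the serving distance $r=R_m$ conditional on $R_m/R_d>R$. Put $$\mathcal H(\beta,\delta,\rho)=\beta^\delta\int_{1/(\rho^2\beta^\delta)}^\infty\frac{dv}{1+v^{1/\delta}}+\delta\pi\frac{\tilde\lambda_F}{\zeta_C\lambda_B}(\beta\tilde P_F)^\delta\csc(\pi\delta),\qquad \mathcal G(\beta,\delta,R)=\mathcal H(\beta,\delta,1)-\mathcal H(\beta,\delta,R).$$ Then the series below converges and $$\mathcal C_{CE}(\beta)=\frac{1-\zeta_C}{1-R^2}\sum_{l=0}^1\frac{(-R^2)^l}{1+R^{2l}\zeta_C\mathcal H(\beta,\delta,1)}+\frac{\zeta_C R^2}{1-R^2}\sum_{n=0}^\infty\sum_{l=0}^1\sum_{k=0}^1\frac{(-1)^{k+l+1}}{(n+k)\zeta_C(1-R^2)+|k-1|\zeta_C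 R^2\mathcal G(\beta,\delta,R)+\zeta_C R^2\mathcal H(\beta,\delta,R)+R^{2l}}.$$ -/

import Mathlib

open MeasureTheory ProbabilityTheory
open scoped ENNReal NNReal

namespace CoChannel

/-- The plane `ℝ²` with its Euclidean norm. The typical user sits at the origin. -/
abbrev Plane : Type := EuclideanSpace ℝ (Fin 2)

section Poisson

variable {Ω : Type*} [MeasurableSpace Ω]

/-- Number of points of the random point set `{x₀, x₁, …}` that lie in `B`. -/
noncomputable def pointCount (x : ℕ → Ω → Plane) (B : Set Plane) (ω : Ω) : ℝ≥0∞ :=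
  ∑' i, B.indicator (fun _ => (1 : ℝ≥0∞)) (x i ω)

/-- `x` is a measurable enumeration of a homogeneous Poisson point process of density `lam` on
`ℝ²`: the number of points in a set of finite area is Poisson with mean `lam * area`, and the
numbers of points in disjoint sets are independent. -/
structure IsPoissonPP (P : Measure Ω) (x : ℕ → Ω → Plane) (lam : ℝ) : Prop where
  measurable : ∀ i, Measurable (x i)
  poisson : ∀ B : Set Plane, MeasurableSet B → volume B ≠ ∞ →
    P.map (pointCount x B) =
      (poissonMeasure (lam.toNNReal * (volume B).toNNReal)).map (fun n : ℕ => (n : ℝ≥0∞))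
  indep : ∀ (n : ℕ) (B : Fin n → Set Plane), (∀ j, MeasurableSet (B j)) →
    Pairwise (Function.onFun Disjoint B) → iIndepFun (fun j => pointCount x (B j)) P

/-- Distance from the origin to the `k`-th closest point (`k ≥ 1`) of `{x₀, x₁, …}`. -/
noncomputable def kthDist (x : ℕ → Ω → Plane) (k : ℕ) (ω : Ω) : ℝ :=
  sInf {ρ : ℝ | (k : ℕ∞) ≤ {i : ℕ | ‖x i ω‖ ≤ ρ}.encard}

end Poisson

section Network

variable {Ω : Type*} [MeasurableSpace Ω]

/-- Labels of the independent sources of randomness: the macro base station (MBS) positions, the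
femto access point (FAP) positions, the fading of the serving link, and, for each MBS / FAP, its
activity on / choice of channel and its fading. -/
inductive Source : Type
  | mbsPos
  | fapPos
  | servingFading
  | mbsActive (i : ℕ)
  | mbsFading (i : ℕ)
  | fapChannel (i : ℕ)
  | fapFading (i : ℕ)

/-- The σ-algebra generated by a source of randomness. -/
def Source.sigma {N : ℕ} (x y : ℕ → Ω → Plane) (act : ℕ → Ω → Bool) (ch : ℕ → Ω → Fin N)
    (h₀ : Ω → ℝ) (h g : ℕ → Ω → ℝ) : Source → MeasurableSpace Ω
  | .mbsPos => MeasurableSpace.comap (fun ω i => x i ω) inferInstance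
  | .fapPos => MeasurableSpace.comap (fun ω i => y i ω) inferInstance
  | .servingFading => MeasurableSpace.comap h₀ inferInstance
  | .mbsActive i => MeasurableSpace.comap (act i) inferInstance
  | .mbsFading i => MeasurableSpace.comap (h i) inferInstance
  | .fapChannel i => MeasurableSpace.comap (ch i) inferInstance
  | .fapFading i => MeasurableSpace.comap (g i) inferInstance

/-- The random two-tier network under co-channel spectrum allocation with `N` channels.
* `x`: positions of the MBSs, a Poisson point process of density `lamB`;
* `y`: positions of the FAPs, a Poisson point process of density `lamF`;
* `act i`: whether the `i`-th MBS uses the typical channel, which has probability `zeta`;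
* `ch i`: the channel used by the `i`-th FAP, uniform among the `N` channels;
* `h₀`, `h i`, `g i`: fading coefficients of the serving MBS, of the `i`-th MBS as an interferer,
  and of the `i`-th FAP, exponential with unit mean.
All of them are mutually independent. -/
structure IsNetwork (P : Measure Ω) (lamB lamF zeta : ℝ) (N : ℕ) (x y : ℕ → Ω → Plane)
    (act : ℕ → Ω → Bool) (ch : ℕ → Ω → Fin N) (h₀ : Ω → ℝ) (h g : ℕ → Ω → ℝ) : Prop where
  mbs : IsPoissonPP P x lamB
  fap : IsPoissonPP P y lamF
  act_measurable : ∀ i, Measurable (act i)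
  act_law : ∀ i, P {ω | act i ω = true} = ENNReal.ofReal zeta
  ch_measurable : ∀ i, Measurable (ch i)
  ch_law : ∀ i (c : Fin N), P {ω | ch i ω = c} = (N : ℝ≥0∞)⁻¹
  servingFading_measurable : Measurable h₀
  servingFading_law : P.map h₀ = expMeasure 1
  mbsFading_measurable : ∀ i, Measurable (h i)
  mbsFading_law : ∀ i, P.map (h i) = expMeasure 1
  fapFading_measurable : ∀ i, Measurable (g i)
  fapFading_law : ∀ i, P.map (g i) = expMeasure 1
  indep : iIndep (Source.sigma x y act ch h₀ h g) P

/-- The user is a cell-edge user: the ratio of the distances to the closest (serving) and second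
closest (dominant interfering) MBS exceeds `R`. -/
def edgeEvent (x : ℕ → Ω → Plane) (R : ℝ) : Set Ω :=
  {ω | R < kthDist x 1 ω / kthDist x 2 ω}

/-- Interference from the co-channel MBSs when the serving MBS is at distance `r`: the co-channel
(active) MBSs, thinned by the activity factor, outside the ball of radius `r`. -/
noncomputable def macroInterference (alpha : ℝ) (x : ℕ → Ω → Plane) (act : ℕ → Ω → Bool)
    (h : ℕ → Ω → ℝ) (r : ℝ) (ω : Ω) : ℝ≥0∞ :=
  ∑' i, if act i ω = true ∧ r ≤ ‖x i ω‖ then ENNReal.ofReal (h i ω * ‖x i ω‖ ^ (-alpha)) else 0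

/-- Interference from the FAPs that use the typical channel `c`; `ratio` is the FAP transmission
power divided by the MBS transmission power. -/
noncomputable def femtoInterference {N : ℕ} (alpha ratio : ℝ) (y : ℕ → Ω → Plane)
    (ch : ℕ → Ω → Fin N) (c : Fin N) (g : ℕ → Ω → ℝ) (ω : Ω) : ℝ≥0∞ :=
  ∑' i, if ch i ω = c then ENNReal.ofReal (g i ω * ‖y i ω‖ ^ (-alpha) * ratio) else 0

/-- Signal-to-interference ratio of a cell-edge user whose serving MBS is at distance `r`. -/
noncomputable def sir {N : ℕ} (alpha ratio : ℝ) (x y : ℕ → Ω → Plane) (act : ℕ → Ω → Bool)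
    (ch : ℕ → Ω → Fin N) (c : Fin N) (h₀ : Ω → ℝ) (h g : ℕ → Ω → ℝ) (r : ℝ) (ω : Ω) : ℝ≥0∞ :=
  ENNReal.ofReal (h₀ ω * r ^ (-alpha)) /
    (macroInterference alpha x act h r ω + femtoInterference alpha ratio y ch c g ω)

/-- At least one co-channel MBS lies in the annulus with radii `r` and `r / R`. -/
def ringEvent (x : ℕ → Ω → Plane) (act : ℕ → Ω → Bool) (R r : ℝ) : Set Ω :=
  {ω | ∃ i, act i ω = true ∧ r ≤ ‖x i ω‖ ∧ ‖x i ω‖ ≤ r / R}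

/-- Coverage probability of a cell-edge user whose serving MBS is at distance `r`. With probability
`zeta` the dominant MBS is co-channel: the co-channel MBSs then form the thinned process outside
the ball of radius `r`, conditioned to have a point in the annulus. With probability `1 - zeta` it
is not: the co-channel MBSs then form the thinned process outside that ball, unconditioned. -/
noncomputable def edgeCoverageAt {N : ℕ} (P : Measure Ω) (alpha ratio zeta R : ℝ)
    (x y : ℕ → Ω → Plane) (act : ℕ → Ω → Bool) (ch : ℕ → Ω → Fin N) (c : Fin N) (h₀ : Ω → ℝ)
    (h g : ℕ → Ω → ℝ) (beta r : ℝ) : ℝ :=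
  zeta * (ProbabilityTheory.cond P (ringEvent x act R r)).real
      {ω | ENNReal.ofReal beta < sir alpha ratio x y act ch c h₀ h g r ω} +
    (1 - zeta) * P.real {ω | ENNReal.ofReal beta < sir alpha ratio x y act ch c h₀ h g r ω}

/-- Coverage probability of a typical cell-edge user: the average of the coverage probability at
distance `r` when `r` has the law of the serving distance of a cell-edge user, that is, the law of
the distance to the closest MBS given the event that the user is a cell-edge user. -/
noncomputable def edgeCoverage {N : ℕ} (P : Measure Ω) (alpha ratio zeta R : ℝ)
    (x y : ℕ → Ω → Plane) (act : ℕ → Ω → Bool) (ch : ℕ → Ω → Fin N) (c : Fin N) (h₀ : Ω → ℝ)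
    (h g : ℕ → Ω → ℝ) (beta : ℝ) : ℝ :=
  ∫ r, edgeCoverageAt P alpha ratio zeta R x y act ch c h₀ h g beta r
    ∂((ProbabilityTheory.cond P (edgeEvent x R)).map (kthDist x 1))

end Network

/-- `H(β, δ, ρ) = β^δ ∫_{1/(ρ²β^δ)}^∞ dv/(1+v^{1/δ}) + δπ (lamFc/(ζ lamB)) (β·ratio)^δ csc(πδ)`,
where `lamFc` is the density of co-channel FAPs. -/
noncomputable def HC (lamB lamFc zeta ratio beta delta rho : ℝ) : ℝ :=
  beta ^ delta * (∫ v in Set.Ioi (1 / (rho ^ 2 * beta ^ delta)), 1 / (1 + v ^ (1 / delta))) +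
    delta * Real.pi * (lamFc / (zeta * lamB)) * (beta * ratio) ^ delta *
      (1 / Real.sin (Real.pi * delta))

/-- `G(β, δ, R) = H(β, δ, 1) - H(β, δ, R)`. -/
noncomputable def GC (lamB lamFc zeta ratio beta delta R : ℝ) : ℝ :=
  HC lamB lamFc zeta ratio beta delta 1 - HC lamB lamFc zeta ratio beta delta R

/-- The `n`-th summand (a double sum over `l, k ∈ {0, 1}`) of the infinite series. -/
noncomputable def seriesTerm (zeta R H G : ℝ) (n : ℕ) : ℝ :=
  ∑ l ∈ Finset.range 2, ∑ k ∈ Finset.range 2,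
    (-1 : ℝ) ^ (k + l + 1) /
      (((n : ℝ) + k) * zeta * (1 - R ^ 2) + |(k : ℝ) - 1| * zeta * R ^ 2 * G
        + zeta * R ^ 2 * H + R ^ (2 * l))

end CoChannel

/-! Fix the serving distance `r` and put `u = lamB * π * r ^ 2`. The serving link has exponential
fading, so coverage has probability `E exp (-s I)` with `s = beta * r ^ alpha` and `I` the total
interference (`measure_lt_div_interference`). The Laplace functional of a marked, thinned Poisson
process (`lintegral_negExp_tsum_thinned`), in polar coordinates, turns this into `exp (-ζ u H(1))`.

Conditioning on a nonempty ring needs the joint probability of coverage and an empty ring. It comes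
from the same functional with a kernel equal to `∞` on the ring; this is why `negExp` lives on `[0,
∞]` with `negExp ∞ = 0`. With `k = ζ (1 / R ^ 2 - 1)`, the empty ring has probability `exp (-k u)`,
and the MBSs that remain lie beyond `r / R`. The conditional coverage is therefore `(exp (-ζ H(1) u)
- exp (-k u) exp (-ζ H(R) u)) / (1 - exp (-k u))` (`edgeCoverageAt_eq`).

The values of `u` for the two closest MBSs are the first two points of a unit-rate Poisson process
on the half-line, with joint density `exp (-v)` on `0 < u < v` (`map_scaledArea`). The edge event is
`v < u / R ^ 2`, so on it `u` has density `exp (-u) - exp (-u / R ^ 2)`, of total mass `1 - R ^ 2`.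
The Laplace transform of this density is `edgeLaplace`.

Expanding `1 / (1 - exp (-k u))` geometrically and integrating termwise gives the series
(`hasSum_edgeLaplace_sub`, `seriesTerm_eq`). The bounds `0 ≤ G ≤ 1 / R ^ 2 - 1` (`GC_bounds`) make
the terms nonnegative and dominated by a telescoping sum, which gives convergence and the exchange
of sum and integral. -/

namespace CoChannel

open Filter Topology

/-! ### Exponentials and Laplace transforms with values in `[0, ∞]` -/

/-- The function `t ↦ exp (-t)` on `[0, ∞]`, with value `0` at `∞`. -/
noncomputable def negExp (t : ℝ≥0∞) : ℝ≥0∞ := EReal.exp (-(t : EReal))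

@[simp] lemma negExp_zero : negExp 0 = 1 := by simp [negExp]

@[simp] lemma negExp_top : negExp ∞ = 0 := by simp [negExp]

lemma continuous_negExp : Continuous negExp :=
  ENNReal.continuous_exp.comp (continuous_neg.comp continuous_coe_ennreal_ereal)

@[fun_prop]
lemma measurable_negExp : Measurable negExp := continuous_negExp.measurable

lemma negExp_antitone : Antitone negExp := fun _ _ hab =>
  EReal.exp_monotone (EReal.neg_le_neg_iff.2 (EReal.coe_ennreal_le_coe_ennreal_iff.2 hab))

lemma negExp_le_one (t : ℝ≥0∞) : negExp t ≤ 1 := by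
  simpa using negExp_antitone (zero_le (a := t))

lemma negExp_ne_top (t : ℝ≥0∞) : negExp t ≠ ∞ :=
  ne_top_of_le_ne_top ENNReal.one_ne_top (negExp_le_one t)

lemma negExp_add (a b : ℝ≥0∞) : negExp (a + b) = negExp a * negExp b := by
  rw [negExp, EReal.coe_ennreal_add, EReal.neg_add, sub_eq_add_neg, EReal.exp_add, negExp, negExp]
  · left; simp
  · right; simp

lemma negExp_ofReal {a : ℝ} (ha : 0 ≤ a) :
    negExp (ENNReal.ofReal a) = ENNReal.ofReal (Real.exp (-a)) := by
  rw [negExp, EReal.coe_ennreal_ofReal, max_eq_left ha, ← EReal.coe_neg, EReal.exp_coe]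

lemma negExp_sum {ι : Type*} (s : Finset ι) (f : ι → ℝ≥0∞) :
    negExp (∑ i ∈ s, f i) = ∏ i ∈ s, negExp (f i) := by
  classical
  induction s using Finset.induction_on with
  | empty => simp
  | insert a s ha ih => rw [Finset.sum_insert ha, Finset.prod_insert ha, negExp_add, ih]

lemma negExp_mul_natCast (a : ℝ≥0∞) (n : ℕ) : negExp (a * n) = negExp a ^ n := by
  have := negExp_sum (Finset.range n) (fun _ => a)
  simpa [mul_comm] using this

lemma tendsto_prod_negExp (f : ℕ → ℝ≥0∞) :
    Tendsto (fun n => ∏ i ∈ Finset.range n, negExp (f i)) atTop (𝓝 (negExp (∑' i, f i))) := by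
  simp_rw [← negExp_sum]
  exact (continuous_negExp.tendsto _).comp (ENNReal.tendsto_nat_tsum f)

/-- The function `t ↦ -log t` on `[0, 1]`, extended by `0`. -/
noncomputable def negLog (t : ℝ≥0∞) : ℝ≥0∞ := (-(ENNReal.log t)).toENNReal

@[fun_prop]
lemma measurable_negLog : Measurable negLog :=
  (continuous_neg.measurable.comp ENNReal.measurable_log).ereal_toENNReal

lemma negExp_negLog {t : ℝ≥0∞} (ht : t ≤ 1) : negExp (negLog t) = t := by
  have : 0 ≤ -ENNReal.log t := by
    rw [EReal.le_neg, neg_zero]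
    simpa using ENNReal.log_monotone ht
  rw [negExp, negLog, EReal.coe_toENNReal this, neg_neg, ENNReal.exp_log]

/-- This is the generating function `exp (-m (1 - z))` at `z = negExp a`. The case `a = ∞`, that is
`z = 0`, is included and gives the probability of the value zero. -/
lemma lintegral_negExp_poisson (m : ℝ≥0) (a : ℝ≥0∞) :
    ∫⁻ n : ℕ, negExp (a * n) ∂(poissonMeasure m) = negExp (m * (1 - negExp a)) := by
  obtain ⟨z, hz⟩ : ∃ z : ℝ≥0, negExp a = z := ⟨_, (ENNReal.coe_toNNReal (negExp_ne_top a)).symm⟩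
  have hz1 : z ≤ 1 := by
    have := negExp_le_one a
    rw [hz] at this
    exact_mod_cast this
  have hr : (m : ℝ≥0∞) * (1 - z) = ENNReal.ofReal (m * (1 - z)) := by
    rw [ENNReal.ofReal_mul m.coe_nonneg, ENNReal.ofReal_sub _ z.coe_nonneg]
    simp
  rw [hz, hr, negExp_ofReal (mul_nonneg m.coe_nonneg (sub_nonneg.2 (by exact_mod_cast hz1))),
    poissonMeasure, lintegral_sum_measure]
  simp_rw [lintegral_smul_measure, lintegral_dirac, negExp_mul_natCast, hz, smul_eq_mul]
  have h1 : ∀ n : ℕ, ENNReal.ofReal (Real.exp (-m) * m ^ n / n.factorial) * (z : ℝ≥0∞) ^ n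
      = ENNReal.ofReal (Real.exp (-m) * ((m * z : ℝ) ^ n / n.factorial)) := by
    intro n
    rw [← ENNReal.ofReal_coe_nnreal, ← ENNReal.ofReal_pow z.coe_nonneg,
      ← ENNReal.ofReal_mul (by positivity)]
    congr 1
    rw [mul_pow]; ring
  simp_rw [h1]
  have hs := (NormedSpace.expSeries_div_hasSum_exp (m * z : ℝ)).mul_left (Real.exp (-m))
  rw [← ENNReal.ofReal_tsum_of_nonneg (fun n => by positivity) hs.summable, hs.tsum_eq,
    ← Real.exp_eq_exp_ℝ, ← Real.exp_add]
  congr 2; ring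

/-! ### Laplace functional of a Poisson point process -/

section Poisson

variable {Ω : Type*} [MeasurableSpace Ω] {P : Measure Ω} {x : ℕ → Ω → Plane} {lam : ℝ}

lemma IsPoissonPP.measurable_pointCount (hx : IsPoissonPP P x lam) {B : Set Plane}
    (hB : MeasurableSet B) : Measurable (pointCount x B) := by
  unfold pointCount
  exact Measurable.tsum fun i => (measurable_const.indicator hB).comp (hx.measurable i)

lemma IsPoissonPP.lintegral_negExp_pointCount (hx : IsPoissonPP P x lam) {B : Set Plane}
    (hB : MeasurableSet B) (hB' : volume B ≠ ∞) (a : ℝ≥0∞) :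
    ∫⁻ ω, negExp (a * pointCount x B ω) ∂P
      = negExp (ENNReal.ofReal lam * ((1 - negExp a) * volume B)) := by
  have h1 : Measurable fun t : ℝ≥0∞ => negExp (a * t) := by fun_prop
  rw [← lintegral_map (f := fun t => negExp (a * t)) h1 (hx.measurable_pointCount hB),
    hx.poisson B hB hB', lintegral_map h1 (by fun_prop), lintegral_negExp_poisson]
  congr 1
  rw [ENNReal.coe_mul, ENNReal.coe_toNNReal hB', ENNReal.ofReal]
  ring

/-- Counts in disjoint sets are independent, so the expectation factors. A zero weight is allowed on
a set of infinite area so that the zero level set of a simple function can be one of the `B j`. -/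
lemma IsPoissonPP.lintegral_negExp_sum_pointCount [IsProbabilityMeasure P]
    (hx : IsPoissonPP P x lam) {n : ℕ}
    (B : Fin n → Set Plane) (a : Fin n → ℝ≥0∞) (hB : ∀ j, MeasurableSet (B j))
    (hd : Pairwise (Function.onFun Disjoint B)) (hfin : ∀ j, a j = 0 ∨ volume (B j) ≠ ∞) :
    ∫⁻ ω, negExp (∑ j, a j * pointCount x (B j) ω) ∂P
      = negExp (ENNReal.ofReal lam * ∑ j, (1 - negExp (a j)) * volume (B j)) := by
  simp_rw [Finset.mul_sum, negExp_sum]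
  have hi := (hx.indep n B hB hd).comp (fun j t => negExp (a j * t)) (fun j => by fun_prop)
  have := lintegral_prod_eq_prod_lintegral_of_indepFun Finset.univ _ hi
    (fun j => (by fun_prop : Measurable fun t : ℝ≥0∞ => negExp (a j * t)).comp
      (hx.measurable_pointCount (hB j)))
  simp only [Function.comp_apply] at this
  rw [this]
  refine Finset.prod_congr rfl fun j _ => ?_
  rcases hfin j with h | h
  · simp [h]
  · exact hx.lintegral_negExp_pointCount (hB j) h _

/-- Grouping the points by the value of `f` makes the sum over points a weighted sum of counts in
the disjoint level sets of `f`. -/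
lemma IsPoissonPP.lintegral_negExp_simpleFunc [IsProbabilityMeasure P]
    (hx : IsPoissonPP P x lam) (f : SimpleFunc Plane ℝ≥0∞)
    (hf : ∀ a, a ≠ 0 → volume (f ⁻¹' {a}) ≠ ∞) :
    ∫⁻ ω, negExp (∑' i, f (x i ω)) ∂P
      = negExp (ENNReal.ofReal lam * ∫⁻ p, (1 - negExp (f p))) := by
  classical
  let e := f.range.equivFin.symm
  have key := hx.lintegral_negExp_sum_pointCount (fun j => f ⁻¹' {(e j : ℝ≥0∞)})
    (fun j => (e j : ℝ≥0∞))
    (fun j => f.measurableSet_fiber _) (fun i j hij => by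
      refine Disjoint.preimage _ (Set.disjoint_singleton.2 fun h => hij ?_)
      exact e.injective (Subtype.ext h)) (fun j => by
      by_cases h : (e j : ℝ≥0∞) = 0
      · exact Or.inl h
      · exact Or.inr (hf _ h))
  have hl : ∀ ω, ∑ j, (e j : ℝ≥0∞) * pointCount x (f ⁻¹' {(e j : ℝ≥0∞)}) ω = ∑' i, f (x i ω) := by
    intro ω
    rw [Equiv.sum_comp e (fun a : f.range => (a : ℝ≥0∞) * pointCount x (f ⁻¹' {(a : ℝ≥0∞)}) ω),
      Finset.sum_coe_sort f.range (fun a => a * pointCount x (f ⁻¹' {a}) ω)]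
    simp_rw [pointCount, ← ENNReal.tsum_mul_left]
    rw [← Summable.tsum_finsetSum (fun _ _ => ENNReal.summable)]
    refine tsum_congr fun i => ?_
    rw [Finset.sum_eq_single (f (x i ω))]
    · simp
    · intro b _ hb
      simp [hb.symm]
    · intro h
      exact absurd (f.mem_range_self _) h
  have hr : ∑ j, (1 - negExp (e j : ℝ≥0∞)) * volume (f ⁻¹' {(e j : ℝ≥0∞)})
      = ∫⁻ p, (1 - negExp (f p)) := by
    rw [Equiv.sum_comp e
      (fun a : f.range => (1 - negExp (a : ℝ≥0∞)) * volume (f ⁻¹' {(a : ℝ≥0∞)})),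
      Finset.sum_coe_sort f.range (fun a => (1 - negExp a) * volume (f ⁻¹' {a})),
      ← SimpleFunc.map_lintegral (fun a => 1 - negExp a) f, ← SimpleFunc.lintegral_eq_lintegral]
    rfl
  simp_rw [hl] at key
  rw [key, hr]

/-- The Laplace functional of a Poisson point process. -/
theorem IsPoissonPP.lintegral_negExp_tsum [IsProbabilityMeasure P]
    (hx : IsPoissonPP P x lam) {f : Plane → ℝ≥0∞} (hf : Measurable f) :
    ∫⁻ ω, negExp (∑' i, f (x i ω)) ∂P
      = negExp (ENNReal.ofReal lam * ∫⁻ p, (1 - negExp (f p))) := by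
  -- Restricting to balls gives the nonzero level sets finite area; the approximation still
  -- increases to `f` pointwise.
  let F : ℕ → SimpleFunc Plane ℝ≥0∞ := fun n =>
    (SimpleFunc.eapprox f n).restrict (Metric.ball 0 n)
  have hFa : ∀ n p, F n p = (Metric.ball (0 : Plane) n).indicator (SimpleFunc.eapprox f n) p :=
    fun n p => SimpleFunc.restrict_apply _ Metric.isOpen_ball.measurableSet _
  have hmono : ∀ p, Monotone fun n => F n p := by
    intro p m n hmn
    simp only [hFa]
    refine (Set.indicator_le_indicator (SimpleFunc.monotone_eapprox f hmn p)).trans ?_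
    exact Set.indicator_le_indicator_of_subset
      (Metric.ball_subset_ball (by exact_mod_cast hmn)) (fun _ => zero_le) p
  have hlim : ∀ p, Tendsto (fun n => F n p) atTop (𝓝 (f p)) := by
    intro p
    refine (SimpleFunc.tendsto_eapprox hf p).congr' ?_
    obtain ⟨N, hN⟩ := exists_nat_gt ‖p‖
    filter_upwards [eventually_ge_atTop N] with n hn
    rw [hFa, Set.indicator_of_mem]
    simpa using hN.trans_le (by exact_mod_cast hn)
  have hF := fun n => hx.lintegral_negExp_simpleFunc (F n) (fun a ha => by
    refine ne_top_of_le_ne_top (measure_ball_lt_top (μ := volume) (x := (0 : Plane)) (r := n)).ne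
      (measure_mono fun p hp => ?_)
    by_contra hpn
    simp only [Set.mem_preimage, Set.mem_singleton_iff, hFa, Set.indicator_of_notMem hpn] at hp
    exact ha hp.symm)
  have hL : Tendsto (fun n => ∫⁻ ω, negExp (∑' i, F n (x i ω)) ∂P) atTop
      (𝓝 (∫⁻ ω, negExp (∑' i, f (x i ω)) ∂P)) := by
    refine tendsto_lintegral_of_dominated_convergence (fun _ => 1) (fun n => ?_)
      (fun n => ae_of_all _ fun ω => negExp_le_one _) (by simp) (ae_of_all _ fun ω => ?_)
    · exact measurable_negExp.comp (Measurable.tsum fun i =>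
        (F n).measurable.comp (hx.measurable i))
    · refine (continuous_negExp.tendsto _).comp ?_
      -- The sum over points is an integral against counting measure, so monotone convergence
      -- applies to it.
      simp_rw [← lintegral_count]
      exact lintegral_tendsto_of_tendsto_of_monotone
        (fun n => (measurable_of_countable _).aemeasurable)
        (ae_of_all _ fun i => hmono _) (ae_of_all _ fun i => hlim _)
  have hR : Tendsto (fun n => negExp (ENNReal.ofReal lam * ∫⁻ p, (1 - negExp (F n p)))) atTop
      (𝓝 (negExp (ENNReal.ofReal lam * ∫⁻ p, (1 - negExp (f p))))) := by
    refine (continuous_negExp.tendsto _).comp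
      (ENNReal.Tendsto.const_mul ?_ (Or.inr ENNReal.ofReal_ne_top))
    refine lintegral_tendsto_of_tendsto_of_monotone (fun n => ?_) (ae_of_all _ fun p => ?_)
      (ae_of_all _ fun p => ?_)
    · exact (measurable_const.sub (measurable_negExp.comp (F n).measurable)).aemeasurable
    · exact fun m n hmn => tsub_le_tsub_left (negExp_antitone (hmono p hmn)) _
    · exact ENNReal.Tendsto.sub tendsto_const_nhds ((continuous_negExp.tendsto _).comp (hlim p))
        (Or.inl ENNReal.one_ne_top)
  simp_rw [hF] at hL
  exact tendsto_nhds_unique hL hR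

end Poisson

/-! ### Independence of blocks of σ-algebras -/

section Independence

variable {Ω : Type*} [mΩ : MeasurableSpace Ω] {P : Measure Ω}

/-- Grouping independent σ-algebras into disjoint blocks yields independent σ-algebras. -/
lemma iIndep_iSup_of_pairwise_disjoint {ι κ : Type*} {m : ι → MeasurableSpace Ω}
    (hle : ∀ i, m i ≤ mΩ) (hm : iIndep m P) {S : κ → Set ι}
    (hS : Pairwise (Function.onFun Disjoint S)) : iIndep (fun k => ⨆ i ∈ S k, m i) P := by
  classical
  have := hm.isProbabilityMeasure
  rw [iIndep_iff]
  intro s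
  induction s using Finset.induction_on with
  | empty => simp
  | insert a s ha ih =>
    intro f hf
    rw [Finset.set_biInter_insert, Finset.prod_insert ha,
      ← ih fun i hi => hf i (Finset.mem_insert_of_mem hi)]
    have hd : Disjoint (S a) (⋃ k ∈ s, S k) := by
      simp only [Set.disjoint_iUnion_right]
      exact fun k hk => hS fun h => ha (h ▸ hk)
    refine (Indep_iff _ _ _).1 (indep_iSup_of_disjoint hle hm hd) _ _
      (hf a (Finset.mem_insert_self _ _)) ?_
    refine Finset.measurableSet_biInter _ fun k hk => ?_
    refine (biSup_mono fun i hi => ?_ : (⨆ i ∈ S k, m i) ≤ ⨆ i ∈ ⋃ k ∈ s, S k, m i) _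
      (hf k (Finset.mem_insert_of_mem hk))
    exact Set.mem_biUnion hk hi

end Independence

/-! ### Marking and thinning -/

section Marked

variable {Ω : Type*} [MeasurableSpace Ω] {P : Measure Ω} [IsProbabilityMeasure P]
  {x : ℕ → Ω → Plane} {lam : ℝ}

/-- The Laplace functional of an independently marked Poisson point process. -/
theorem IsPoissonPP.lintegral_negExp_tsum_marked (hx : IsPoissonPP P x lam) {T : Type*}
    [MeasurableSpace T] {M : ℕ → Ω → T} (hM : ∀ i, Measurable (M i)) {ν : Measure T}
    [IsProbabilityMeasure ν] (hν : ∀ i, P.map (M i) = ν) (hind : iIndepFun M P)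
    (hxM : IndepFun (fun ω i => x i ω) (fun ω i => M i ω) P) {φ : Plane × T → ℝ≥0∞}
    (hφ : Measurable φ) :
    ∫⁻ ω, negExp (∑' i, φ (x i ω, M i ω)) ∂P
      = negExp (ENNReal.ofReal lam * ∫⁻ p, (1 - ∫⁻ t, negExp (φ (p, t)) ∂ν)) := by
  set ψ : Plane → ℝ≥0∞ := fun p => ∫⁻ t, negExp (φ (p, t)) ∂ν 
  have hψm : Measurable ψ := (measurable_negExp.comp hφ).lintegral_prod_right'
  have hψ1 : ∀ p, ψ p ≤ 1 := fun p =>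
    (lintegral_mono fun t => negExp_le_one _).trans (by simp)
  have hX : Measurable fun ω i => x i ω := measurable_pi_lambda _ hx.measurable
  have hMm : Measurable fun ω i => M i ω := measurable_pi_lambda _ hM
  have hprod := (indepFun_iff_map_prod_eq_prod_map_map hX.aemeasurable hMm.aemeasurable).1 hxM
  -- With the positions frozen by Fubini, the marks are integrated out one factor at a time; finite
  -- products suffice because both sides pass to the limit.
  have hfin : ∀ n, ∫⁻ ω, ∏ i ∈ Finset.range n, negExp (φ (x i ω, M i ω)) ∂P
      = ∫⁻ ω, ∏ i ∈ Finset.range n, ψ (x i ω) ∂P := by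
    intro n
    have hg : Measurable fun z : (ℕ → Plane) × (ℕ → T) =>
        ∏ i ∈ Finset.range n, negExp (φ (z.1 i, z.2 i)) := by
      refine Finset.measurable_prod _ fun i _ => measurable_negExp.comp (hφ.comp ?_)
      exact ((measurable_pi_apply i).comp measurable_fst).prodMk
        ((measurable_pi_apply i).comp measurable_snd)
    rw [← lintegral_map (f := fun z : (ℕ → Plane) × (ℕ → T) =>
        ∏ i ∈ Finset.range n, negExp (φ (z.1 i, z.2 i))) hg (hX.prodMk hMm), hprod,
      lintegral_prod _ hg.aemeasurable, lintegral_map hg.lintegral_prod_right' hX]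
    refine lintegral_congr fun ω => ?_
    have hm1 : ∀ i, Measurable fun t => negExp (φ (x i ω, t)) := fun i =>
      measurable_negExp.comp (hφ.comp measurable_prodMk_left)
    rw [lintegral_map (f := fun y : ℕ → T => ∏ i ∈ Finset.range n, negExp (φ (x i ω, y i)))
      (hg.comp measurable_prodMk_left) hMm]
    have := lintegral_prod_eq_prod_lintegral_of_indepFun (Finset.range n) _
      (hind.comp (fun i t => negExp (φ (x i ω, t))) hm1) (fun i => (hm1 i).comp (hM i))
    simp only [Function.comp_apply] at this
    rw [this]
    refine Finset.prod_congr rfl fun i _ => ?_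
    rw [← lintegral_map (f := fun t => negExp (φ (x i ω, t))) (hm1 i) (hM i), hν i]
  have hlim : ∀ F : Ω → ℕ → ℝ≥0∞, (∀ i, Measurable fun ω => F ω i) →
      Tendsto (fun n => ∫⁻ ω, ∏ i ∈ Finset.range n, negExp (F ω i) ∂P) atTop
        (𝓝 (∫⁻ ω, negExp (∑' i, F ω i) ∂P)) := by
    intro F hF
    refine tendsto_lintegral_of_dominated_convergence (fun _ => 1) (fun n => ?_)
      (fun n => ae_of_all _ fun ω => ?_) (by simp) (ae_of_all _ fun ω => tendsto_prod_negExp _)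
    · exact Finset.measurable_prod _ fun i _ => measurable_negExp.comp (hF i)
    · exact Finset.prod_le_one' fun i _ => negExp_le_one _
  have h1 := hlim (fun ω i => φ (x i ω, M i ω)) fun i => hφ.comp ((hx.measurable i).prodMk (hM i))
  -- Writing `ψ = negExp (negLog ψ)` turns the product over points back into `negExp` of a sum, to
  -- which the unmarked functional applies with kernel `negLog ∘ ψ`.
  have h2 := hlim (fun ω i => negLog (ψ (x i ω))) fun i =>
    measurable_negLog.comp (hψm.comp (hx.measurable i))
  simp only [negExp_negLog (hψ1 _)] at h2
  simp only [hfin] at h1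
  rw [tendsto_nhds_unique h1 h2,
    hx.lintegral_negExp_tsum (f := fun p => negLog (ψ p)) (measurable_negLog.comp hψm)]
  simp only [negExp_negLog (hψ1 _)]
  rfl

/-- The Laplace functional of an independently marked and thinned Poisson point process. -/
theorem IsPoissonPP.lintegral_negExp_tsum_thinned (hx : IsPoissonPP P x lam) {T : Type*}
    [MeasurableSpace T] {act : ℕ → Ω → Bool} {h : ℕ → Ω → T} {q : ℝ} {μ : Measure T}
    [IsProbabilityMeasure μ] (hlam : 0 ≤ lam) (hact : ∀ i, Measurable (act i))
    (hactq : ∀ i, P {ω | act i ω = true} = ENNReal.ofReal q)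
    (hh : ∀ i, Measurable (h i)) (hμ : ∀ i, P.map (h i) = μ)
    (hah : ∀ i, IndepFun (act i) (h i) P)
    (hind : iIndepFun (fun i ω => (act i ω, h i ω)) P)
    (hxM : IndepFun (fun ω i => x i ω) (fun ω i => (act i ω, h i ω)) P) {K : Plane × T → ℝ≥0∞}
    (hK : Measurable K) :
    ∫⁻ ω, negExp (∑' i, if act i ω = true then K (x i ω, h i ω) else 0) ∂P
      = negExp (ENNReal.ofReal (lam * q) * ∫⁻ p, (1 - ∫⁻ t, negExp (K (p, t)) ∂μ)) := by
  set ρ : Measure Bool := P.map (act 0)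
  have hρtrue : ∀ i, (P.map (act i)) {true} = ENNReal.ofReal q := fun i => by
    rw [Measure.map_apply (hact i) (measurableSet_singleton _), ← hactq i]
    rfl
  have hprob : ∀ i, IsProbabilityMeasure (P.map (act i)) := fun i =>
    Measure.isProbabilityMeasure_map (hact i).aemeasurable
  have hρprob : IsProbabilityMeasure ρ := hprob 0
  have hfalse : ∀ (ρ' : Measure Bool) [IsProbabilityMeasure ρ'], ρ' {false} = 1 - ρ' {true} := by
    intro ρ' _
    rw [← prob_compl_eq_one_sub (measurableSet_singleton _)]
    congr 1
    ext b
    cases b <;> simp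
  have hρ : ∀ i, P.map (act i) = ρ := fun i => by
    refine Measure.ext_of_singleton fun b => ?_
    cases b
    · rw [hfalse, hfalse, hρtrue, hρtrue]
    · rw [hρtrue, hρtrue]
  have hlaw : ∀ i, P.map (fun ω => (act i ω, h i ω)) = ρ.prod μ := fun i => by
    rw [(indepFun_iff_map_prod_eq_prod_map_map (hact i).aemeasurable (hh i).aemeasurable).1 (hah i),
      hρ, hμ]
  have hφ : Measurable fun z : Plane × (Bool × T) =>
      if z.2.1 = true then K (z.1, z.2.2) else 0 := by
    refine Measurable.ite ?_ (hK.comp (by fun_prop)) measurable_const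
    exact (measurable_fst.comp measurable_snd) (measurableSet_singleton true)
  rw [hx.lintegral_negExp_tsum_marked (fun i => (hact i).prodMk (hh i)) hlaw hind hxM hφ,
    ENNReal.ofReal_mul hlam, mul_assoc]
  congr 2
  have hKm : Measurable fun p => ∫⁻ t, negExp (K (p, t)) ∂μ :=
    (measurable_negExp.comp hK).lintegral_prod_right'
  rw [← lintegral_const_mul _ (hKm.const_sub 1)]
  refine lintegral_congr fun p => ?_
  have hm : Measurable fun t : Bool × T => negExp (if t.1 = true then K (p, t.2) else 0) :=
    measurable_negExp.comp (hφ.comp measurable_prodMk_left)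
  have h01 : ∫⁻ t, negExp (K (p, t)) ∂μ ≤ 1 :=
    (lintegral_mono fun t => negExp_le_one _).trans (by simp)
  have hq1 : ENNReal.ofReal q ≤ 1 := hactq 0 ▸ prob_le_one
  rw [lintegral_prod _ hm.aemeasurable, lintegral_fintype]
  simp only [Fintype.univ_bool, Finset.mem_singleton, Bool.true_eq_false, not_false_eq_true,
    Finset.sum_insert, Finset.sum_singleton, if_true, Bool.false_eq_true, if_false, negExp_zero,
    lintegral_const, measure_univ, mul_one, one_mul, hfalse ρ]
  rw [show ρ {true} = ENNReal.ofReal q from hρtrue 0]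
  -- What remains is `1 - (q w + (1 - q)) = q (1 - w)`. Subtraction is truncated, hence the bounds
  -- `w ≤ 1` and `q ≤ 1`.
  generalize ∫⁻ t, negExp (K (p, t)) ∂μ = w at *
  lift w to ℝ≥0 using ne_top_of_le_ne_top ENNReal.one_ne_top h01
  rw [ENNReal.ofReal] at *
  generalize q.toNNReal = q' at *
  norm_cast at *
  rw [← NNReal.coe_inj, NNReal.coe_sub, NNReal.coe_add, NNReal.coe_mul, NNReal.coe_mul,
    NNReal.coe_sub hq1, NNReal.coe_sub h01]
  · simp; ring
  · calc w * q' + (1 - q') ≤ 1 * q' + (1 - q') := by gcongr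
      _ = 1 := by rw [one_mul, add_tsub_cancel_of_le hq1]

end Marked

/-! ### Exponential fading -/

section Exponential

lemma expMeasure_one_Ioi {t : ℝ} (ht : 0 ≤ t) :
    expMeasure 1 (Set.Ioi t) = ENNReal.ofReal (Real.exp (-t)) := by
  have := isProbabilityMeasure_expMeasure one_pos
  have h := cdf_expMeasure_eq one_pos t
  rw [if_pos ht, cdf_eq_real, one_mul] at h
  rw [← Set.compl_Iic, ← ENNReal.ofReal_toReal (measure_ne_top _ (Set.Iic t)ᶜ)]
  change ENNReal.ofReal ((expMeasure 1).real (Set.Iic t)ᶜ) = _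
  rw [probReal_compl_eq_one_sub measurableSet_Iic, h]
  congr 1; ring

/-- The Laplace transform of the exponential distribution with unit mean. -/
lemma lintegral_negExp_expMeasure {a : ℝ} (ha : 0 ≤ a) :
    ∫⁻ t, negExp (ENNReal.ofReal (a * t)) ∂(expMeasure 1) = ENNReal.ofReal (1 / (1 + a)) := by
  have hm : Measurable fun t : ℝ => negExp (ENNReal.ofReal (a * t)) := by fun_prop
  have hpdf : expMeasure 1 = volume.withDensity (exponentialPDF 1) := rfl
  have hpm : Measurable (exponentialPDF 1) := (measurable_exponentialPDFReal 1).ennreal_ofReal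
  rw [hpdf, lintegral_withDensity_eq_lintegral_mul _ hpm hm]
  have h1 : ∀ t : ℝ, (exponentialPDF 1 * fun t : ℝ => negExp (ENNReal.ofReal (a * t))) t
      = (Set.Ici (0 : ℝ)).indicator (fun t => ENNReal.ofReal (Real.exp (-(1 + a) * t))) t := by
    intro t
    rw [Pi.mul_apply, exponentialPDF_eq]
    by_cases ht : 0 ≤ t
    · rw [if_pos ht, Set.indicator_of_mem (Set.mem_Ici.2 ht), negExp_ofReal (mul_nonneg ha ht),
        ← ENNReal.ofReal_mul (by positivity), one_mul, one_mul, ← Real.exp_add]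
      congr 2; ring
    · rw [if_neg ht, Set.indicator_of_notMem (by simpa using ht)]
      simp
  rw [lintegral_congr h1, lintegral_indicator measurableSet_Ici, ← restrict_Ioi_eq_restrict_Ici,
    ← ofReal_integral_eq_lintegral_ofReal
      (exp_neg_integrableOn_Ioi 0 (by positivity)) (ae_of_all _ fun t => (Real.exp_pos _).le),
    integral_exp_mul_Ioi (by linarith)]
  congr 1
  rw [mul_zero, Real.exp_zero, neg_div_neg_eq]

variable {Ω : Type*} [MeasurableSpace Ω] {P : Measure Ω} [IsProbabilityMeasure P]

/-- Under Rayleigh fading the coverage probability is the Laplace transform of the interference. -/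
lemma measure_lt_div_interference {h₀ : Ω → ℝ} {I : Ω → ℝ≥0∞} (hh : Measurable h₀)
    (hlaw : P.map h₀ = expMeasure 1) (hI : Measurable I) (hind : IndepFun I h₀ P) {alpha beta r : ℝ}
    (hr : 0 < r) (hbeta : 0 < beta) :
    P {ω | ENNReal.ofReal beta < ENNReal.ofReal (h₀ ω * r ^ (-alpha)) / I ω}
      = ∫⁻ ω, negExp (ENNReal.ofReal (beta * r ^ alpha) * I ω) ∂P := by
  have hr0 : 0 < r ^ alpha := Real.rpow_pos_of_pos hr _
  set S : Set (ℝ≥0∞ × ℝ) :=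
    {z | ENNReal.ofReal beta < ENNReal.ofReal (z.2 * r ^ (-alpha)) / z.1} with hS
  have hSm : MeasurableSet S := measurableSet_lt measurable_const (by fun_prop)
  have h1 := (indepFun_iff_map_prod_eq_prod_map_map hI.aemeasurable hh.aemeasurable).1 hind
  have := isProbabilityMeasure_expMeasure one_pos
  have h2 : P {ω | ENNReal.ofReal beta < ENNReal.ofReal (h₀ ω * r ^ (-alpha)) / I ω}
      = P.map (fun ω => (I ω, h₀ ω)) S := by
    rw [Measure.map_apply (hI.prodMk hh) hSm]
    rfl
  rw [h2, h1, hlaw, Measure.prod_apply hSm, lintegral_map (measurable_measure_prodMk_left hSm) hI]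
  refine lintegral_congr fun ω => ?_
  generalize I ω = i
  -- Clearing the denominator is valid even for `i = 0` and `i = ∞`, because `beta` is neither zero
  -- nor infinite.
  have hset : Prod.mk i ⁻¹' S
      = {t : ℝ | ENNReal.ofReal beta * i < ENNReal.ofReal (t * r ^ (-alpha))} := by
    ext t
    simp only [hS, Set.mem_preimage, Set.mem_ofPred_eq]
    exact ENNReal.lt_div_iff_mul_lt (Or.inr ENNReal.ofReal_ne_top)
      (Or.inr (ENNReal.ofReal_pos.2 hbeta).ne')
  rw [hset]
  induction i using ENNReal.recTopCoe with
  | top =>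
    simp [ENNReal.mul_top, hbeta, mul_pos hbeta hr0, not_le]
  | coe i =>
    have hi : (i : ℝ≥0∞) = ENNReal.ofReal (i : ℝ) := (ENNReal.ofReal_coe_nnreal).symm
    rw [hi, ← ENNReal.ofReal_mul (by positivity), ← ENNReal.ofReal_mul (by positivity),
      negExp_ofReal (by positivity), ← expMeasure_one_Ioi (by positivity)]
    congr 1
    ext t
    simp only [Set.mem_ofPred_eq, Set.mem_Ioi]
    rw [ENNReal.ofReal_lt_ofReal_iff', Real.rpow_neg hr.le, ← div_eq_mul_inv, lt_div_iff₀ hr0,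
      mul_right_comm]
    constructor
    · exact fun h => h.1
    · intro h
      exact ⟨h, div_pos (lt_of_le_of_lt (by positivity) h) hr0⟩

end Exponential

/-! ### Measurability and independence of the network's sources of randomness -/

lemma measurable_tsum_ite {Ω T : Type*} [MeasurableSpace Ω] [MeasurableSpace T] {x : ℕ → Ω → Plane}
    {p : ℕ → Ω → Prop} [∀ i ω, Decidable (p i ω)] {h : ℕ → Ω → T}
    (hx : ∀ i, Measurable (x i)) (hp : ∀ i, MeasurableSet {ω | p i ω})
    (hh : ∀ i, Measurable (h i)) {K : Plane × T → ℝ≥0∞} (hK : Measurable K) :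
    Measurable fun ω => ∑' i, if p i ω then K (x i ω, h i ω) else 0 :=
  Measurable.tsum fun i =>
    Measurable.ite (hp i) (hK.comp ((hx i).prodMk (hh i))) measurable_const

section Network

variable {Ω : Type*} {lamB lamF zeta : ℝ} {N : ℕ} {x y : ℕ → Ω → Plane} {act : ℕ → Ω → Bool}
  {ch : ℕ → Ω → Fin N} {h₀ : Ω → ℝ}
  {h g : ℕ → Ω → ℝ}

/-- The σ-algebra generated by a set of sources of randomness. -/
@[reducible] def sourceSigma (x y : ℕ → Ω → Plane) (act : ℕ → Ω → Bool) (ch : ℕ → Ω → Fin N)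
    (h₀ : Ω → ℝ) (h g : ℕ → Ω → ℝ) (S : Set Source) : MeasurableSpace Ω :=
  ⨆ s ∈ S, Source.sigma x y act ch h₀ h g s

/-- The sources of randomness of the MBS tier. -/
def macroSources : Set Source :=
  {s | s = .mbsPos ∨ ∃ i, s = .mbsActive i ∨ s = .mbsFading i}

/-- The sources of randomness of the FAP tier. -/
def femtoSources : Set Source :=
  {s | s = .fapPos ∨ ∃ i, s = .fapChannel i ∨ s = .fapFading i}

lemma measurable_sourceSigma_of_comap_le {T : Type*} [mT : MeasurableSpace T] {f : Ω → T}
    {S : Set Source} {s : Source} (hs : s ∈ S)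
    (hf : mT.comap f ≤ Source.sigma x y act ch h₀ h g s) :
    Measurable[sourceSigma x y act ch h₀ h g S] f :=
  measurable_iff_comap_le.2 (hf.trans (le_iSup₂_of_le s hs le_rfl))

lemma measurable_sourceSigma_pos {S : Set Source} (hs : .mbsPos ∈ S) (i : ℕ) :
    Measurable[sourceSigma x y act ch h₀ h g S] (x i) :=
  (measurable_pi_apply i).comp
    (measurable_sourceSigma_of_comap_le (f := fun ω i => x i ω) hs le_rfl)

lemma measurable_sourceSigma_fapPos {S : Set Source} (hs : .fapPos ∈ S) (i : ℕ) :
    Measurable[sourceSigma x y act ch h₀ h g S] (y i) :=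
  (measurable_pi_apply i).comp
    (measurable_sourceSigma_of_comap_le (f := fun ω i => y i ω) hs le_rfl)

lemma measurable_sourceSigma_macro {K : Plane × ℝ → ℝ≥0∞} (hK : Measurable K) :
    Measurable[sourceSigma x y act ch h₀ h g macroSources]
      fun ω => ∑' i, if act i ω = true then K (x i ω, h i ω) else 0 := by
  -- The σ-algebra on `Ω` is passed explicitly: measurability is needed for the one generated by the
  -- macro sources, not for the ambient one.
  refine @measurable_tsum_ite _ _ (_) _ _ _ _ _ (measurable_sourceSigma_pos (Or.inl rfl))
    (fun i => ?_) (fun i => ?_) _ hK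
  · exact measurable_sourceSigma_of_comap_le (f := act i) (s := .mbsActive i)
      (Or.inr ⟨i, Or.inl rfl⟩) le_rfl (measurableSet_singleton true)
  · exact measurable_sourceSigma_of_comap_le (s := .mbsFading i) (Or.inr ⟨i, Or.inr rfl⟩) le_rfl

lemma measurable_sourceSigma_femto (c : Fin N) {K : Plane × ℝ → ℝ≥0∞} (hK : Measurable K) :
    Measurable[sourceSigma x y act ch h₀ h g femtoSources]
      fun ω => ∑' i, if ch i ω = c then K (y i ω, g i ω) else 0 := by
  refine @measurable_tsum_ite _ _ (_) _ _ _ _ _ (measurable_sourceSigma_fapPos (Or.inl rfl))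
    (fun i => ?_) (fun i => ?_) _ hK
  · exact measurable_sourceSigma_of_comap_le (f := ch i) (s := .fapChannel i)
      (Or.inr ⟨i, Or.inl rfl⟩) le_rfl (measurableSet_singleton c)
  · exact measurable_sourceSigma_of_comap_le (s := .fapFading i) (Or.inr ⟨i, Or.inr rfl⟩) le_rfl

namespace IsNetwork

variable [mΩ : MeasurableSpace Ω] {P : Measure Ω}
variable (hnet : IsNetwork P lamB lamF zeta N x y act ch h₀ h g)
include hnet

lemma sigma_le (s : Source) : Source.sigma x y act ch h₀ h g s ≤ mΩ := by
  cases s with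
  | mbsPos => exact (measurable_pi_lambda _ hnet.mbs.measurable).comap_le
  | fapPos => exact (measurable_pi_lambda _ hnet.fap.measurable).comap_le
  | servingFading => exact hnet.servingFading_measurable.comap_le
  | mbsActive i => exact (hnet.act_measurable i).comap_le
  | mbsFading i => exact (hnet.mbsFading_measurable i).comap_le
  | fapChannel i => exact (hnet.ch_measurable i).comap_le
  | fapFading i => exact (hnet.fapFading_measurable i).comap_le

/-- All pairwise independence in the model is obtained here, by exhibiting disjoint sets of sources
on which the two variables depend. -/
lemma indepFun_of_disjoint {T T' : Type*} [MeasurableSpace T] [MeasurableSpace T'] {f : Ω → T}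
    {f' : Ω → T'} {S S' : Set Source} (hS : Disjoint S S')
    (hf : Measurable[sourceSigma x y act ch h₀ h g S] f)
    (hf' : Measurable[sourceSigma x y act ch h₀ h g S'] f') : IndepFun f f' P :=
  indep_of_indep_of_le (indep_iSup_of_disjoint hnet.sigma_le hnet.indep hS)
    (measurable_iff_comap_le.1 hf) (measurable_iff_comap_le.1 hf')

lemma iIndepFun_of_pairwise_disjoint {T : Type*} [MeasurableSpace T] {f : ℕ → Ω → T}
    {S : ℕ → Set Source} (hS : Pairwise (Function.onFun Disjoint S))
    (hf : ∀ i, Measurable[sourceSigma x y act ch h₀ h g (S i)] (f i)) : iIndepFun f P :=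
  iIndep_of_iIndep_of_le (iIndep_iSup_of_pairwise_disjoint hnet.sigma_le hnet.indep hS)
    fun i => measurable_iff_comap_le.1 (hf i)

/-- The Laplace functional of the marked co-channel MBSs. -/
lemma lintegral_negExp_macro [IsProbabilityMeasure P] (hlam : 0 ≤ lamB) {K : Plane × ℝ → ℝ≥0∞}
    (hK : Measurable K) :
    ∫⁻ ω, negExp (∑' i, if act i ω = true then K (x i ω, h i ω) else 0) ∂P
      = negExp (ENNReal.ofReal (lamB * zeta) *
          ∫⁻ p, (1 - ∫⁻ t, negExp (K (p, t)) ∂(expMeasure 1))) := by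
  have := isProbabilityMeasure_expMeasure one_pos
  have hpair : ∀ (S : Set Source) i, .mbsActive i ∈ S → .mbsFading i ∈ S →
      Measurable[sourceSigma x y act ch h₀ h g S] fun ω => (act i ω, h i ω) := fun S i h1 h2 =>
    Measurable.prodMk (measurable_sourceSigma_of_comap_le h1 le_rfl)
      (measurable_sourceSigma_of_comap_le h2 le_rfl)
  refine hnet.mbs.lintegral_negExp_tsum_thinned hlam hnet.act_measurable hnet.act_law
    hnet.mbsFading_measurable hnet.mbsFading_law (fun i => ?_) ?_ ?_ hK
  · exact hnet.indepFun_of_disjoint (S := {.mbsActive i}) (S' := {.mbsFading i}) (by simp)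
      (measurable_sourceSigma_of_comap_le rfl le_rfl)
      (measurable_sourceSigma_of_comap_le rfl le_rfl)
  · refine hnet.iIndepFun_of_pairwise_disjoint (S := fun i => {.mbsActive i, .mbsFading i})
      (fun i j hij => ?_) fun i => hpair _ i (by simp) (by simp)
    simp [Function.onFun, hij.symm]
  · refine hnet.indepFun_of_disjoint (S := {.mbsPos})
      (S' := {s | ∃ i, s = .mbsActive i ∨ s = .mbsFading i}) (by simp)
      (measurable_sourceSigma_of_comap_le rfl le_rfl) 
      (@measurable_pi_lambda _ _ _ (_) _ _ fun i => ?_)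
    exact hpair _ i ⟨i, Or.inl rfl⟩ ⟨i, Or.inr rfl⟩

/-- The Laplace functional of the marked co-channel FAPs. -/
lemma lintegral_negExp_femto [IsProbabilityMeasure P] (hlam : 0 ≤ lamF) (c : Fin N)
    {K : Plane × ℝ → ℝ≥0∞} (hK : Measurable K) :
    ∫⁻ ω, negExp (∑' i, if ch i ω = c then K (y i ω, g i ω) else 0) ∂P
      = negExp (ENNReal.ofReal (lamF / N) *
          ∫⁻ p, (1 - ∫⁻ t, negExp (K (p, t)) ∂(expMeasure 1))) := by
  have := isProbabilityMeasure_expMeasure one_pos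
  have hN : 0 < N := c.pos
  -- The event of choosing channel `c` plays the role of the activity mark, with probability `1 /
  -- N`.
  have hdec : Measurable fun k : Fin N => decide (k = c) := measurable_of_countable _
  have hpair : ∀ (S : Set Source) i, .fapChannel i ∈ S → .fapFading i ∈ S →
      Measurable[sourceSigma x y act ch h₀ h g S] fun ω => (decide (ch i ω = c), g i ω) :=
    fun S i h1 h2 => Measurable.prodMk
      (hdec.comp (measurable_sourceSigma_of_comap_le (f := ch i) h1 le_rfl))
      (measurable_sourceSigma_of_comap_le h2 le_rfl)
  have key := hnet.fap.lintegral_negExp_tsum_thinned (act := fun i ω => decide (ch i ω = c))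
    (q := 1 / N) hlam (fun i => hdec.comp (hnet.ch_measurable i)) (fun i => ?_)
    hnet.fapFading_measurable hnet.fapFading_law (fun i => ?_) ?_ ?_ hK
  · rw [div_eq_mul_one_div lamF, ← key]
    simp only [decide_eq_true_eq]
  · simp only [decide_eq_true_eq]
    rw [hnet.ch_law, one_div, ENNReal.ofReal_inv_of_pos (by exact_mod_cast hN),
      ENNReal.ofReal_natCast]
  · exact hnet.indepFun_of_disjoint (S := {.fapChannel i}) (S' := {.fapFading i}) (by simp)
      (hdec.comp (measurable_sourceSigma_of_comap_le (f := ch i) rfl le_rfl))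
      (measurable_sourceSigma_of_comap_le rfl le_rfl)
  · refine hnet.iIndepFun_of_pairwise_disjoint (S := fun i => {.fapChannel i, .fapFading i})
      (fun i j hij => ?_) fun i => hpair _ i (by simp) (by simp)
    simp [Function.onFun, hij.symm]
  · refine hnet.indepFun_of_disjoint (S := {.fapPos})
      (S' := {s | ∃ i, s = .fapChannel i ∨ s = .fapFading i}) (by simp)
      (measurable_sourceSigma_of_comap_le rfl le_rfl) 
      (@measurable_pi_lambda _ _ _ (_) _ _ fun i => ?_)
    exact hpair _ i ⟨i, Or.inl rfl⟩ ⟨i, Or.inr rfl⟩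

end IsNetwork

end Network

/-! ### Planar integrals of the interference kernel -/

/-- Polar coordinates in the plane, in terms of the squared radius. -/
lemma map_norm_sq_volume :
    (volume : Measure Plane).map (fun p => ‖p‖ ^ 2)
      = ENNReal.ofReal Real.pi • volume.restrict (Set.Ioi 0) := by
  have hm : Measurable fun p : Plane => ‖p‖ ^ 2 := by fun_prop
  have hIic : ∀ a : ℝ, (volume : Measure Plane).map (fun p => ‖p‖ ^ 2) (Set.Iic a)
      = ENNReal.ofReal Real.pi * ENNReal.ofReal a := by
    intro a
    rw [Measure.map_apply hm measurableSet_Iic]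
    rcases lt_or_ge a 0 with ha | ha
    · have : (fun p : Plane => ‖p‖ ^ 2) ⁻¹' Set.Iic a = ∅ := by
        ext p
        simp only [Set.mem_preimage, Set.mem_Iic, Set.mem_empty_iff_false, iff_false, not_le]
        exact ha.trans_le (by positivity)
      rw [this, measure_empty, ENNReal.ofReal_of_nonpos ha.le, mul_zero]
    · have : (fun p : Plane => ‖p‖ ^ 2) ⁻¹' Set.Iic a = Metric.closedBall 0 (√a) := by
        ext p
        simp [Real.le_sqrt (norm_nonneg p) ha]
      rw [this, EuclideanSpace.volume_closedBall_fin_two, ← ENNReal.ofReal_pow (Real.sqrt_nonneg a),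
        Real.sq_sqrt ha, mul_comm]
  -- Half-lines determine the measure: the preimage of `Iic a` for `a ≥ 0` is a disc of radius `√a`
  -- and area `π a`.
  refine Measure.ext_of_generateFrom_of_iUnion (Set.range Set.Iic) (fun n : ℕ => Set.Iic (n : ℝ))
    (borel_eq_generateFrom_Iic ℝ ▸ BorelSpace.measurable_eq) isPiSystem_Iic ?_ (fun n => ⟨n, rfl⟩)
    (fun n => ?_) ?_
  · refine Set.eq_univ_of_forall fun t => Set.mem_iUnion.2 ?_
    obtain ⟨n, hn⟩ := exists_nat_ge t
    exact ⟨n, hn⟩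
  · rw [hIic]
    exact ENNReal.mul_ne_top ENNReal.ofReal_ne_top ENNReal.ofReal_ne_top
  · rintro _ ⟨a, rfl⟩
    rw [hIic, Measure.smul_apply, smul_eq_mul, Measure.restrict_apply measurableSet_Iic,
      Set.inter_comm, Set.Ioi_inter_Iic, Real.volume_Ioc, sub_zero]

lemma lintegral_norm_sq {f : ℝ → ℝ≥0∞} (hf : Measurable f) :
    ∫⁻ p : Plane, f (‖p‖ ^ 2) = ENNReal.ofReal Real.pi * ∫⁻ t in Set.Ioi 0, f t := by
  rw [← lintegral_map (f := f) hf (by fun_prop : Measurable fun p : Plane => ‖p‖ ^ 2),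
    map_norm_sq_volume, lintegral_smul_measure, smul_eq_mul]

lemma lintegral_exp_neg_mul {b : ℝ} (hb : 0 < b) :
    ∫⁻ w in Set.Ioi (0 : ℝ), ENNReal.ofReal (Real.exp (-b * w)) = ENNReal.ofReal (1 / b) := by
  rw [← ofReal_integral_eq_lintegral_ofReal (exp_neg_integrableOn_Ioi 0 hb)
    (ae_of_all _ fun t => (Real.exp_pos _).le), integral_exp_mul_Ioi (by linarith)]
  congr 1
  rw [mul_zero, Real.exp_zero, neg_div_neg_eq]

/-- Write `1 / (1 + v ^ p)`, with `p = 1 / delta`, as the integral of `exp (-(1 + v ^ p) w)` over `w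
> 0` and swap. The `v`-integral is `Γ(delta + 1) w ^ (-delta)`, the `w`-integral then gives `Γ(1 -
delta)`, and the reflection formula finishes. -/
lemma lintegral_one_div_one_add_rpow {delta : ℝ} (h0 : 0 < delta) (h1 : delta < 1) :
    ∫⁻ v in Set.Ioi (0 : ℝ), ENNReal.ofReal (1 / (1 + v ^ (1 / delta)))
      = ENNReal.ofReal (delta * Real.pi * (1 / Real.sin (Real.pi * delta))) := by
  have hp : 0 < 1 / delta := by positivity
  have e1 : ∫⁻ v in Set.Ioi (0 : ℝ), ENNReal.ofReal (1 / (1 + v ^ (1 / delta)))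
      = ∫⁻ v in Set.Ioi (0 : ℝ), ∫⁻ w in Set.Ioi (0 : ℝ),
          ENNReal.ofReal (Real.exp (-(1 + v ^ (1 / delta)) * w)) := by
    refine setLIntegral_congr_fun measurableSet_Ioi fun v (hv : 0 < v) => ?_
    have := Real.rpow_pos_of_pos hv (1 / delta)
    rw [lintegral_exp_neg_mul (by positivity)]
  have hm : Measurable (Function.uncurry fun v w : ℝ =>
      ENNReal.ofReal (Real.exp (-(1 + v ^ (1 / delta)) * w))) := by
    unfold Function.uncurry
    fun_prop
  rw [e1, lintegral_lintegral_swap hm.aemeasurable]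
  have e2 : ∀ w ∈ Set.Ioi (0 : ℝ), ∫⁻ v in Set.Ioi (0 : ℝ),
      ENNReal.ofReal (Real.exp (-(1 + v ^ (1 / delta)) * w))
        = ENNReal.ofReal (Real.Gamma (delta + 1)) *
          ENNReal.ofReal (Real.exp (-w) * w ^ ((1 - delta) - 1)) := by
    intro w hw
    have hw' : 0 < w := hw
    have hi := integral_exp_neg_mul_rpow hp hw'
    have hint : IntegrableOn (fun v : ℝ => Real.exp (-w * v ^ (1 / delta))) (Set.Ioi 0) := by
      -- A nonintegrable function has Bochner integral zero, so the positive closed form itself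
      -- proves integrability.
      refine Integrable.of_integral_ne_zero ?_
      rw [hi]
      have := Real.Gamma_pos_of_pos (by positivity : 0 < 1 / (1 / delta) + 1)
      positivity
    have hs : ∀ v : ℝ, ENNReal.ofReal (Real.exp (-(1 + v ^ (1 / delta)) * w))
        = ENNReal.ofReal (Real.exp (-w)) * ENNReal.ofReal (Real.exp (-w * v ^ (1 / delta))) := by
      intro v
      rw [← ENNReal.ofReal_mul (Real.exp_pos _).le, ← Real.exp_add]
      congr 2; ring
    simp_rw [hs]
    rw [lintegral_const_mul _ (by fun_prop), ← ofReal_integral_eq_lintegral_ofReal hint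
      (ae_of_all _ fun t => (Real.exp_pos _).le), hi, ← ENNReal.ofReal_mul (Real.exp_pos _).le,
      ← ENNReal.ofReal_mul (Real.Gamma_pos_of_pos (by positivity)).le]
    congr 1
    rw [one_div_one_div, neg_div, one_div_one_div, sub_sub_cancel_left]
    ring
  rw [setLIntegral_congr_fun measurableSet_Ioi e2, lintegral_const_mul _ (by fun_prop),
    ← ofReal_integral_eq_lintegral_ofReal (Real.GammaIntegral_convergent (by linarith))
      (ae_restrict_of_forall_mem measurableSet_Ioi fun w (hw : 0 < w) => by positivity),
    ← Real.Gamma_eq_integral (by linarith),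
    ← ENNReal.ofReal_mul (Real.Gamma_pos_of_pos (by positivity)).le, Real.Gamma_add_one h0.ne',
    mul_assoc, Real.Gamma_mul_Gamma_one_sub, mul_assoc, mul_one_div]

lemma one_div_one_add_rpow_nonneg {v : ℝ} (hv : 0 ≤ v) (p : ℝ) : 0 ≤ 1 / (1 + v ^ p) := by
  have := Real.rpow_nonneg hv p
  positivity

lemma integrableOn_one_div_one_add_rpow {delta : ℝ} (h0 : 0 < delta) (h1 : delta < 1) :
    IntegrableOn (fun v : ℝ => 1 / (1 + v ^ (1 / delta))) (Set.Ioi 0) := by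
  refine ⟨Measurable.aestronglyMeasurable (by fun_prop), ?_⟩
  rw [hasFiniteIntegral_iff_ofReal (ae_restrict_of_forall_mem measurableSet_Ioi
    fun v (hv : 0 < v) => one_div_one_add_rpow_nonneg hv.le _),
    lintegral_one_div_one_add_rpow h0 h1]
  exact ENNReal.ofReal_lt_top

lemma integral_one_div_one_add_rpow {delta : ℝ} (h0 : 0 < delta) (h1 : delta < 1) :
    ∫ v in Set.Ioi (0 : ℝ), 1 / (1 + v ^ (1 / delta))
      = delta * Real.pi * (1 / Real.sin (Real.pi * delta)) := by
  have hs : 0 < Real.sin (Real.pi * delta) :=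
    Real.sin_pos_of_pos_of_lt_pi (by positivity) (by nlinarith [Real.pi_pos])
  rw [integral_eq_lintegral_of_nonneg_ae (ae_restrict_of_forall_mem measurableSet_Ioi
    fun v (hv : 0 < v) => one_div_one_add_rpow_nonneg hv.le _)
    (Measurable.aestronglyMeasurable (by fun_prop)),
    lintegral_one_div_one_add_rpow h0 h1, ENNReal.toReal_ofReal (by positivity)]

/-- The integrated Laplace exponent of Rayleigh-faded interference from outside a disc. -/
lemma lintegral_interference {alpha delta a : ℝ} (halpha : 2 < alpha) (hdelta : delta = 2 / alpha)
    (ha : 0 < a) {rho : ℝ} (hrho : 0 ≤ rho) :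
    ∫⁻ p : Plane, {p : Plane | rho < ‖p‖}.indicator
        (fun p => ENNReal.ofReal (1 - 1 / (1 + a * ‖p‖ ^ (-alpha)))) p
      = ENNReal.ofReal (Real.pi * (a ^ delta *
          ∫ v in Set.Ioi (rho ^ 2 / a ^ delta), 1 / (1 + v ^ (1 / delta)))) := by
  have hd0 : 0 < delta := by rw [hdelta]; positivity
  have hd1 : delta < 1 := by rw [hdelta, div_lt_one (by linarith)]; exact halpha
  have hk : 0 < a ^ delta := Real.rpow_pos_of_pos ha _
  set k := a ^ delta with hkdef
  have hkd : k ^ (1 / delta) = a := by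
    rw [hkdef, ← Real.rpow_mul ha.le, mul_one_div_cancel hd0.ne', Real.rpow_one]
  -- In the variable `t = ‖p‖ ^ 2` one has `t ^ (1 / delta) = ‖p‖ ^ alpha`. Dividing by `k = a ^
  -- delta` absorbs the factor `a`, which leaves `1 / (1 + v ^ (1 / delta))` at `v = t / k`.
  set f : ℝ → ℝ≥0∞ := (Set.Ioi (rho ^ 2)).indicator
    fun t => ENNReal.ofReal (1 / (1 + (t / k) ^ (1 / delta)))
  have hf : Measurable f := Measurable.indicator (by fun_prop) measurableSet_Ioi
  have hfa : ∀ t, f t = (Set.Ioi (rho ^ 2)).indicator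
    (fun t => ENNReal.ofReal (1 / (1 + (t / k) ^ (1 / delta)))) t := fun _ => rfl
  have e1 : ∀ p : Plane, {p : Plane | rho < ‖p‖}.indicator
        (fun p => ENNReal.ofReal (1 - 1 / (1 + a * ‖p‖ ^ (-alpha)))) p = f (‖p‖ ^ 2) := by
    intro p
    rw [hfa]
    by_cases hp : rho < ‖p‖
    · have hp0 : 0 < ‖p‖ := hrho.trans_lt hp
      have hpa : 0 < ‖p‖ ^ alpha := Real.rpow_pos_of_pos hp0 _
      rw [Set.indicator_of_mem (show p ∈ {p : Plane | rho < ‖p‖} from hp),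
        Set.indicator_of_mem (show ‖p‖ ^ 2 ∈ Set.Ioi (rho ^ 2) from
          pow_lt_pow_left₀ hp hrho two_ne_zero), Real.div_rpow (by positivity) hk.le, hkd,
        ← Real.rpow_natCast, ← Real.rpow_mul hp0.le, Real.rpow_neg hp0.le]
      have : ((2 : ℕ) : ℝ) * (1 / delta) = alpha := by
        rw [hdelta]; push_cast; field_simp
      rw [this]
      congr 1
      field_simp
      ring
    · rw [Set.indicator_of_notMem (show p ∉ {p : Plane | rho < ‖p‖} from hp),
        Set.indicator_of_notMem]
      simp only [Set.mem_Ioi, not_lt]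
      exact pow_le_pow_left₀ (norm_nonneg p) (not_lt.1 hp) 2
  have hsub : Set.Ioi (rho ^ 2) ⊆ Set.Ioi (0 : ℝ) := Set.Ioi_subset_Ioi (by positivity)
  have hint := integrableOn_one_div_one_add_rpow hd0 hd1
  have hint2 : IntegrableOn (fun t : ℝ => 1 / (1 + (t / k) ^ (1 / delta))) (Set.Ioi 0) := by
    have := (integrableOn_Ioi_comp_mul_right_iff
      (fun v : ℝ => 1 / (1 + v ^ (1 / delta))) 0 (inv_pos.2 hk)).2 (by simpa using hint)
    simpa [div_eq_mul_inv] using this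
  rw [lintegral_congr e1, lintegral_norm_sq hf, lintegral_indicator measurableSet_Ioi,
    Measure.restrict_restrict measurableSet_Ioi, Set.inter_eq_left.2 hsub,
    ← ofReal_integral_eq_lintegral_ofReal (hint2.mono_set hsub)
      (ae_restrict_of_forall_mem measurableSet_Ioi fun t (ht : rho ^ 2 < t) =>
        one_div_one_add_rpow_nonneg (div_nonneg ((sq_nonneg rho).trans ht.le) hk.le) _),
    ← ENNReal.ofReal_mul Real.pi_pos.le]
  congr 2
  have := integral_comp_mul_right_Ioi (fun v : ℝ => 1 / (1 + v ^ (1 / delta))) (rho ^ 2)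
    (inv_pos.2 hk)
  simpa [div_eq_mul_inv] using this

/-! ### Void and coverage probabilities at a fixed serving distance -/

section Network

variable {Ω : Type*} {lamB lamF zeta : ℝ} {N : ℕ} {x y : ℕ → Ω → Plane} {act : ℕ → Ω → Bool}
  {ch : ℕ → Ω → Fin N} {h₀ : Ω → ℝ}
  {h g : ℕ → Ω → ℝ}

/-- No co-channel MBS lies in `A`. -/
def avoidEvent (x : ℕ → Ω → Plane) (act : ℕ → Ω → Bool) (A : Set Plane) : Set Ω :=
  {ω | ∀ i, act i ω = true → x i ω ∉ A}

/-- Since `negExp ∞ = 0` and `negExp 0 = 1`, this kernel makes the Laplace functional compute void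
probabilities. -/
lemma tsum_ite_top_eq (x : ℕ → Ω → Plane) (act : ℕ → Ω → Bool) (A : Set Plane) (ω : Ω) :
    (∑' i, if act i ω = true then A.indicator (fun _ => (∞ : ℝ≥0∞)) (x i ω) else 0)
      = (avoidEvent x act A)ᶜ.indicator (fun _ => ∞) ω := by
  by_cases hω : ω ∈ avoidEvent x act A
  · rw [Set.indicator_of_notMem (by simpa using hω), ENNReal.tsum_eq_zero]
    intro i
    split_ifs with hi
    · exact Set.indicator_of_notMem (hω i hi) _
    · rfl
  · rw [Set.indicator_of_mem (by simpa using hω)]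
    simp only [avoidEvent, Set.mem_ofPred_eq, not_forall, not_not] at hω
    obtain ⟨i, hi, hA⟩ := hω
    refine ENNReal.tsum_eq_top_of_eq_top ⟨i, ?_⟩
    rw [if_pos hi, Set.indicator_of_mem hA]

variable [mΩ : MeasurableSpace Ω] {P : Measure Ω}

lemma IsNetwork.measurableSet_avoidEvent (hnet : IsNetwork P lamB lamF zeta N x y act ch h₀ h g)
    {A : Set Plane} (hA : MeasurableSet A) : MeasurableSet (avoidEvent x act A) := by
  have : avoidEvent x act A = ⋂ i, ({ω | act i ω = true}ᶜ ∪ (x i ⁻¹' A)ᶜ) := by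
    ext ω
    simp [avoidEvent, imp_iff_not_or]
  rw [this]
  exact MeasurableSet.iInter fun i =>
    ((hnet.act_measurable i) (measurableSet_singleton true)).compl.union
      ((hnet.mbs.measurable i) hA).compl

variable [IsProbabilityMeasure P]

/-- The void probability of the co-channel MBSs. -/
lemma IsNetwork.measure_avoidEvent (hnet : IsNetwork P lamB lamF zeta N x y act ch h₀ h g)
    (hlam : 0 ≤ lamB) {A : Set Plane} (hA : MeasurableSet A) :
    P (avoidEvent x act A) = negExp (ENNReal.ofReal (lamB * zeta) * volume A) := by
  have := isProbabilityMeasure_expMeasure one_pos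
  have key := hnet.lintegral_negExp_macro hlam
    (K := fun z => A.indicator (fun _ => (∞ : ℝ≥0∞)) z.1)
    ((measurable_const.indicator hA).comp measurable_fst)
  have h1 : ∀ ω, negExp (∑' i, if act i ω = true then
      A.indicator (fun _ => (∞ : ℝ≥0∞)) (x i ω) else 0)
      = (avoidEvent x act A).indicator 1 ω := by
    intro ω
    rw [tsum_ite_top_eq]
    by_cases hω : ω ∈ avoidEvent x act A <;> simp [hω]
  have h2 : ∀ p, (1 : ℝ≥0∞) - ∫⁻ t, negExp (A.indicator (fun _ => (∞ : ℝ≥0∞)) p) ∂(expMeasure 1)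
      = A.indicator 1 p := by
    intro p
    by_cases hp : p ∈ A <;> simp [hp]
  simp_rw [h1, h2] at key
  rwa [lintegral_indicator_one (hnet.measurableSet_avoidEvent hA), lintegral_indicator_one hA]
    at key

/-- The interference from a point at `p` with fading coefficient `t`, scaled by `s`. -/
noncomputable def scaledInterference (s alpha : ℝ) (z : Plane × ℝ) : ℝ≥0∞ :=
  ENNReal.ofReal (s * ‖z.1‖ ^ (-alpha) * z.2)

lemma measurable_scaledInterference (s alpha : ℝ) : Measurable (scaledInterference s alpha) := by
  unfold scaledInterference
  fun_prop

lemma one_sub_lintegral_scaledInterference {s : ℝ} (hs : 0 ≤ s) (alpha : ℝ) (p : Plane) :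
    1 - ∫⁻ t, negExp (scaledInterference s alpha (p, t)) ∂(expMeasure 1)
      = ENNReal.ofReal (1 - 1 / (1 + s * ‖p‖ ^ (-alpha))) := by
  have hw : 0 ≤ s * ‖p‖ ^ (-alpha) := mul_nonneg hs (Real.rpow_nonneg (norm_nonneg p) _)
  simp only [scaledInterference]
  rw [lintegral_negExp_expMeasure hw, ENNReal.ofReal_sub _ (by positivity), ENNReal.ofReal_one]

/-- Joint probability of coverage and of a void `A` in the co-channel MBS process. -/
lemma IsNetwork.measure_avoidEvent_inter_covered
    (hnet : IsNetwork P lamB lamF zeta N x y act ch h₀ h g)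
    (hlamB : 0 ≤ lamB) (hlamF : 0 ≤ lamF) (c : Fin N) {A : Set Plane} (hA : MeasurableSet A)
    {alpha ratio beta r : ℝ} (hratio : 0 < ratio) (hbeta : 0 < beta) (hr : 0 < r) :
    P (avoidEvent x act A ∩ {ω | ENNReal.ofReal beta < sir alpha ratio x y act ch c h₀ h g r ω})
      = negExp (ENNReal.ofReal (lamB * zeta) * (volume A +
            ∫⁻ p : Plane, ({p : Plane | r ≤ ‖p‖} \ A).indicator (fun p =>
              ENNReal.ofReal (1 - 1 / (1 + beta * r ^ alpha * ‖p‖ ^ (-alpha)))) p)) *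
          negExp (ENNReal.ofReal (lamF / N) * ∫⁻ p : Plane,
              ENNReal.ofReal (1 - 1 / (1 + beta * r ^ alpha * ratio * ‖p‖ ^ (-alpha)))) := by
  classical
  have := isProbabilityMeasure_expMeasure one_pos
  have hra : 0 < r ^ alpha := Real.rpow_pos_of_pos hr _
  have hs : 0 < beta * r ^ alpha := by positivity
  set s := beta * r ^ alpha with hsdef
  have hD : MeasurableSet {p : Plane | r ≤ ‖p‖} := measurableSet_le measurable_const measurable_norm
  -- interference kernels with unit scaling and a fatal obstruction on `A`
  set K : ℝ → Plane × ℝ → ℝ≥0∞ := fun a z => A.indicator (fun _ => ∞) z.1 +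
    if r ≤ ‖z.1‖ then scaledInterference a alpha z else 0 with hKdef
  have hK : ∀ a, Measurable (K a) := fun a =>
    ((measurable_const.indicator hA).comp measurable_fst).add
      (Measurable.ite (measurable_fst hD) (measurable_scaledInterference a alpha) measurable_const)
  set J : Ω → ℝ≥0∞ := fun ω => ∑' i, if act i ω = true then K 1 (x i ω, h i ω) else 0 with hJ
  set F : Ω → ℝ≥0∞ := fun ω => ∑' i, if ch i ω = c then
    scaledInterference ratio alpha (y i ω, g i ω) else 0 with hF
  have hJm : Measurable[sourceSigma x y act ch h₀ h g macroSources] J :=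
    measurable_sourceSigma_macro (hK 1)
  have hFm : Measurable[sourceSigma x y act ch h₀ h g femtoSources] F :=
    measurable_sourceSigma_femto c (measurable_scaledInterference ratio alpha)
  have hle : ∀ S, sourceSigma x y act ch h₀ h g S ≤ mΩ := fun S =>
    iSup₂_le fun s _ => hnet.sigma_le s
  have hJm' : Measurable J := hJm.mono (hle _) le_rfl
  have hFm' : Measurable F := hFm.mono (hle _) le_rfl
  have hmono : ∀ {S S' : Set Source}, S ⊆ S' →
      sourceSigma x y act ch h₀ h g S ≤ sourceSigma x y act ch h₀ h g S' :=
    fun hSS => biSup_mono hSS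
  -- The two interference fields use disjoint sets of sources, and neither uses the fading of the
  -- serving link.
  have hJF : IndepFun J F P := by
    refine hnet.indepFun_of_disjoint (Set.disjoint_left.2 ?_) hJm hFm
    rintro s (rfl | ⟨i, rfl | rfl⟩) (h' | ⟨j, h' | h'⟩) <;> cases h'
  have hI0 : IndepFun (fun ω => J ω + F ω) h₀ P := by
    refine hnet.indepFun_of_disjoint (S := macroSources ∪ femtoSources) (S' := {.servingFading})
      (Set.disjoint_left.2 ?_) (@Measurable.add _ _ _ _ _ (_) _ _
        (hJm.mono (hmono Set.subset_union_left) le_rfl)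
        (hFm.mono (hmono Set.subset_union_right) le_rfl))
      (measurable_sourceSigma_of_comap_le rfl le_rfl)
    rintro s ((h' | ⟨j, h' | h'⟩) | (h' | ⟨j, h' | h'⟩)) rfl <;> cases h'
  -- the event in terms of the obstructed interference
  have hJ_eq : ∀ ω, J ω = (avoidEvent x act A)ᶜ.indicator (fun _ => ∞) ω +
      macroInterference alpha x act h r ω := by
    intro ω
    rw [← tsum_ite_top_eq, macroInterference, ← ENNReal.tsum_add]
    refine tsum_congr fun i => ?_
    simp only [hKdef, scaledInterference, one_mul]
    by_cases h1 : act i ω = true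
    · simp [h1, mul_comm]
    · simp [h1]
  have hfemto : ∀ ω, femtoInterference alpha ratio y ch c g ω = F ω := by
    intro ω
    rw [femtoInterference]
    refine tsum_congr fun i => ?_
    simp only [scaledInterference]
    congr 2
    ring
  -- Off the void event `J` is infinite, the quotient is zero and coverage fails, so a single SIR
  -- event encodes both conditions.
  have hset : avoidEvent x act A ∩
      {ω | ENNReal.ofReal beta < sir alpha ratio x y act ch c h₀ h g r ω}
      = {ω | ENNReal.ofReal beta < ENNReal.ofReal (h₀ ω * r ^ (-alpha)) / (J ω + F ω)} := by
    ext ω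
    simp only [Set.mem_inter_iff, Set.mem_ofPred_eq, sir, hfemto, hJ_eq]
    by_cases hω : ω ∈ avoidEvent x act A <;> simp [hω]
  have hscaleJ : ∀ ω, ENNReal.ofReal s * J ω
      = ∑' i, if act i ω = true then K s (x i ω, h i ω) else 0 := by
    intro ω
    rw [hJ, ← ENNReal.tsum_mul_left]
    refine tsum_congr fun i => ?_
    simp only [hKdef, scaledInterference, mul_ite, mul_zero, mul_add, one_mul]
    -- Scaling by `s > 0` leaves the value `∞` on `A` unchanged.
    rw [← ENNReal.ofReal_mul hs.le, ← mul_assoc]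
    by_cases hA' : x i ω ∈ A
    · simp [hA', hs]
    · simp [hA']
  have hscaleF : ∀ ω, ENNReal.ofReal s * F ω
      = ∑' i, if ch i ω = c then scaledInterference (s * ratio) alpha (y i ω, g i ω) else 0 := by
    intro ω
    rw [hF, ← ENNReal.tsum_mul_left]
    refine tsum_congr fun i => ?_
    simp only [scaledInterference, mul_ite, mul_zero]
    rw [← ENNReal.ofReal_mul hs.le, ← mul_assoc, ← mul_assoc]
  have hKint : ∀ p : Plane, 1 - ∫⁻ t, negExp (K s (p, t)) ∂(expMeasure 1)
      = A.indicator 1 p + ({p : Plane | r ≤ ‖p‖} \ A).indicator (fun p =>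
              ENNReal.ofReal (1 - 1 / (1 + s * ‖p‖ ^ (-alpha)))) p := by
    intro p
    by_cases hpA : p ∈ A
    · simp [hKdef, hpA]
    · by_cases hpr : r ≤ ‖p‖
      · simp only [hKdef, hpA, hpr, not_false_eq_true, Set.indicator_of_notMem, if_true, zero_add]
        rw [one_sub_lintegral_scaledInterference hs.le, 
          Set.indicator_of_mem (show p ∈ {p : Plane | r ≤ ‖p‖} \ A from ⟨hpr, hpA⟩)]
      · simp [hKdef, hpA, hpr]
  rw [hset, measure_lt_div_interference (I := fun ω => J ω + F ω)
    hnet.servingFading_measurable hnet.servingFading_law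
    (hJm'.add hFm') hI0 hr hbeta, ← hsdef]
  simp_rw [mul_add, negExp_add]
  have hmul : Measurable fun t : ℝ≥0∞ => negExp (ENNReal.ofReal s * t) := by fun_prop
  rw [lintegral_mul_eq_lintegral_mul_lintegral_of_indepFun''
    (f := fun ω => negExp (ENNReal.ofReal s * J ω)) (g := fun ω => negExp (ENNReal.ofReal s * F ω))
    (hmul.comp hJm').aemeasurable
    (hmul.comp hFm').aemeasurable (hJF.comp hmul hmul)]
  simp_rw [hscaleJ, hscaleF]
  rw [hnet.lintegral_negExp_macro hlamB (hK s), hnet.lintegral_negExp_femto hlamF c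
    (measurable_scaledInterference (s * ratio) alpha)]
  simp_rw [hKint, one_sub_lintegral_scaledInterference (mul_pos hs hratio).le]
  rw [lintegral_add_left (measurable_one.indicator hA), lintegral_indicator_one hA, mul_add,
    negExp_add]

end Network

/-- Because `alpha * delta = 2`, every Laplace exponent depends on `r` only through a factor `r ^
2`, which is what makes the final average explicit. -/
lemma mul_rpow_rpow_delta {alpha delta b r : ℝ} (halpha : 0 < alpha) (hdelta : delta = 2 / alpha)
    (hb : 0 < b) (hr : 0 < r) : (b * r ^ alpha) ^ delta = b ^ delta * r ^ 2 := by
  rw [Real.mul_rpow hb.le (Real.rpow_nonneg hr.le _), ← Real.rpow_mul hr.le, hdelta,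
    mul_div_cancel₀ _ halpha.ne', Real.rpow_two]

lemma negExp_ofReal_mul_ofReal {a b : ℝ} (ha : 0 ≤ a) (hb : 0 ≤ b) :
    negExp (ENNReal.ofReal a * ENNReal.ofReal b) = ENNReal.ofReal (Real.exp (-(a * b))) := by
  rw [← ENNReal.ofReal_mul ha, negExp_ofReal (mul_nonneg ha hb)]

lemma setIntegral_one_div_one_add_rpow_nonneg {c : ℝ} (hc : 0 ≤ c) (p : ℝ) :
    0 ≤ ∫ v in Set.Ioi c, 1 / (1 + v ^ p) :=
  setIntegral_nonneg measurableSet_Ioi fun _ (hv : c < _) =>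
    one_div_one_add_rpow_nonneg (hc.trans hv.le) p

/-- The product of the Laplace transforms of the two interference fields, the MBS field being
restricted to the outside of the disc of radius `r / rho`. -/
lemma negExp_macro_mul_negExp_femto {lamB lamFc zeta alpha delta beta ratio r rho : ℝ}
    (hlamB : 0 < lamB) (hlamFc : 0 ≤ lamFc) (hzeta : 0 < zeta) (halpha : 2 < alpha)
    (hdelta : delta = 2 / alpha) (hbeta : 0 < beta) (hratio : 0 < ratio) (hr : 0 < r)
    (hrho : 0 < rho) :
    negExp (ENNReal.ofReal (lamB * zeta) *
        ∫⁻ p : Plane, {p : Plane | r / rho < ‖p‖}.indicator (fun p =>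
          ENNReal.ofReal (1 - 1 / (1 + beta * r ^ alpha * ‖p‖ ^ (-alpha)))) p) *
      negExp (ENNReal.ofReal lamFc * ∫⁻ p : Plane,
          ENNReal.ofReal (1 - 1 / (1 + beta * r ^ alpha * ratio * ‖p‖ ^ (-alpha))))
      = ENNReal.ofReal (Real.exp (-(zeta * (lamB * Real.pi * r ^ 2) *
          HC lamB lamFc zeta ratio beta delta rho))) := by
  have ha0 : 0 < alpha := by linarith
  have hd0 : 0 < delta := by rw [hdelta]; positivity
  have hd1 : delta < 1 := by rw [hdelta, div_lt_one (by linarith)]; exact halpha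
  have hra : 0 < r ^ alpha := Real.rpow_pos_of_pos hr _
  have hbd : 0 < beta ^ delta := Real.rpow_pos_of_pos hbeta _
  have hbrd : 0 < (beta * ratio) ^ delta := Real.rpow_pos_of_pos (by positivity) _
  have hsin : 0 < Real.sin (Real.pi * delta) :=
    Real.sin_pos_of_pos_of_lt_pi (by positivity) (by nlinarith [Real.pi_pos])
  -- The FAP field has no exclusion disc, which is inner radius `0`. At the origin `0 ^ (-alpha) =
  -- 0` by convention, so the integrand vanishes there.
  have hfem : ∀ p : Plane, ENNReal.ofReal (1 - 1 / (1 + beta * r ^ alpha * ratio * ‖p‖ ^ (-alpha)))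
      = {p : Plane | 0 < ‖p‖}.indicator (fun p =>
          ENNReal.ofReal (1 - 1 / (1 + beta * r ^ alpha * ratio * ‖p‖ ^ (-alpha)))) p := by
    intro p
    by_cases hp : p = 0
    · simp [hp, Real.zero_rpow (neg_ne_zero.2 ha0.ne')]
    · rw [Set.indicator_of_mem (show p ∈ {p : Plane | 0 < ‖p‖} from norm_pos_iff.2 hp)]
  have hI : 0 ≤ ∫ v in Set.Ioi (1 / (rho ^ 2 * beta ^ delta)), 1 / (1 + v ^ (1 / delta)) :=
    setIntegral_one_div_one_add_rpow_nonneg (by positivity) _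
  rw [lintegral_congr hfem, lintegral_interference halpha hdelta (by positivity) (by positivity),
    lintegral_interference halpha hdelta (by positivity) le_rfl,
    mul_right_comm beta, mul_rpow_rpow_delta ha0 hdelta hbeta hr,
    mul_rpow_rpow_delta ha0 hdelta (by positivity) hr,
    show (r / rho) ^ 2 / (beta ^ delta * r ^ 2) = 1 / (rho ^ 2 * beta ^ delta) by field_simp,
    show (0 : ℝ) ^ 2 / ((beta * ratio) ^ delta * r ^ 2) = 0 by simp,
    integral_one_div_one_add_rpow hd0 hd1,
    negExp_ofReal_mul_ofReal (by positivity) (by positivity),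
    negExp_ofReal_mul_ofReal hlamFc (by positivity), ← ENNReal.ofReal_mul (Real.exp_pos _).le,
    ← Real.exp_add, HC]
  congr 2
  field_simp
  ring

/-- The annulus with radii `r` and `r / R`. -/
def annulus (R r : ℝ) : Set Plane := {p | r ≤ ‖p‖ ∧ ‖p‖ ≤ r / R}

lemma measurableSet_annulus (R r : ℝ) : MeasurableSet (annulus R r) :=
  (measurableSet_le measurable_const measurable_norm).inter
    (measurableSet_le measurable_norm measurable_const)

lemma volume_annulus {R r : ℝ} (hR : 0 < R) (hR1 : R < 1) (hr : 0 < r) :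
    volume (annulus R r) = ENNReal.ofReal (Real.pi * r ^ 2 * (1 / R ^ 2 - 1)) := by
  have hrR : r ≤ r / R := by rw [le_div_iff₀ hR]; nlinarith
  have : annulus R r = Metric.closedBall 0 (r / R) \ Metric.ball 0 r := by
    ext p
    simp [annulus, and_comm]
  rw [this, measure_sdiff (Metric.ball_subset_closedBall.trans
      (Metric.closedBall_subset_closedBall hrR))
    measurableSet_ball.nullMeasurableSet measure_ball_lt_top.ne,
    EuclideanSpace.volume_closedBall_fin_two, EuclideanSpace.volume_ball_fin_two,
    ← ENNReal.ofReal_pow hr.le, ← ENNReal.ofReal_pow (by positivity)]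
  rw [← ENNReal.ofReal_mul (by positivity), ← ENNReal.ofReal_mul (by positivity),
    ← ENNReal.ofReal_sub _ (by positivity)]
  congr 1
  field_simp

section Network

variable {Ω : Type*} [mΩ : MeasurableSpace Ω] {P : Measure Ω} [IsProbabilityMeasure P]
  {lamB lamF zeta : ℝ} {N : ℕ} {x y : ℕ → Ω → Plane} {act : ℕ → Ω → Bool} {ch : ℕ → Ω → Fin N}
  {h₀ : Ω → ℝ} {h g : ℕ → Ω → ℝ}

/-- Coverage probability at distance `r` without conditioning. -/
lemma IsNetwork.measureReal_covered (hnet : IsNetwork P lamB lamF zeta N x y act ch h₀ h g)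
    (hlamB : 0 < lamB) (hlamF : 0 < lamF) (hzeta : 0 < zeta) (c : Fin N)
    {alpha delta ratio beta r : ℝ} (halpha : 2 < alpha) (hdelta : delta = 2 / alpha)
    (hratio : 0 < ratio) (hbeta : 0 < beta) (hr : 0 < r) :
    P.real {ω | ENNReal.ofReal beta < sir alpha ratio x y act ch c h₀ h g r ω}
      = Real.exp (-(zeta * (lamB * Real.pi * r ^ 2) *
          HC lamB (lamF / N) zeta ratio beta delta 1)) := by
  have key := hnet.measure_avoidEvent_inter_covered hlamB.le hlamF.le c MeasurableSet.empty
    (alpha := alpha) hratio hbeta hr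
  have h1 : avoidEvent x act ∅ = Set.univ := by
    ext ω; simp [avoidEvent]
  rw [h1, Set.univ_inter, measure_empty, zero_add, Set.sdiff_empty] at key
  -- The closed and open exclusion conditions differ only on a circle, which is null.
  have h2 : (fun p : Plane => {p : Plane | r ≤ ‖p‖}.indicator (fun p =>
      ENNReal.ofReal (1 - 1 / (1 + beta * r ^ alpha * ‖p‖ ^ (-alpha)))) p) =ᵐ[volume]
      fun p => {p : Plane | r / 1 < ‖p‖}.indicator (fun p =>
      ENNReal.ofReal (1 - 1 / (1 + beta * r ^ alpha * ‖p‖ ^ (-alpha)))) p := by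
    have : ∀ᵐ p : Plane, p ∉ Metric.sphere (0 : Plane) r :=
      measure_eq_zero_iff_ae_notMem.1 (Measure.addHaar_sphere _ _ _)
    filter_upwards [this] with p hp
    have hp' : r ≠ ‖p‖ := fun h => hp (by simp [h])
    simp [Set.indicator_apply, hp'.le_iff_lt]
  rw [lintegral_congr_ae h2, negExp_macro_mul_negExp_femto hlamB (by positivity) hzeta halpha hdelta
    hbeta hratio hr one_pos] at key
  rw [measureReal_def, key, ENNReal.toReal_ofReal (Real.exp_pos _).le]

omit mΩ in
lemma ringEvent_eq_compl_avoidEvent (x : ℕ → Ω → Plane) (act : ℕ → Ω → Bool) (R r : ℝ) :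
    ringEvent x act R r = (avoidEvent x act (annulus R r))ᶜ := by
  ext ω
  simp [ringEvent, avoidEvent, annulus]

/-- The coverage probability of a cell-edge user whose serving MBS is at distance `r`. -/
lemma IsNetwork.edgeCoverageAt_eq (hnet : IsNetwork P lamB lamF zeta N x y act ch h₀ h g)
    (hlamB : 0 < lamB) (hlamF : 0 < lamF) (hzeta : 0 < zeta) (c : Fin N)
    {alpha delta ratio beta R r : ℝ} (halpha : 2 < alpha) (hdelta : delta = 2 / alpha)
    (hratio : 0 < ratio) (hbeta : 0 < beta) (hR : 0 < R) (hR1 : R < 1) (hr : 0 < r) :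
    edgeCoverageAt P alpha ratio zeta R x y act ch c h₀ h g beta r
      = zeta * ((Real.exp (-(zeta * (lamB * Real.pi * r ^ 2) *
              HC lamB (lamF / N) zeta ratio beta delta 1)) -
            Real.exp (-(zeta * (lamB * Real.pi * r ^ 2) * (1 / R ^ 2 - 1))) *
              Real.exp (-(zeta * (lamB * Real.pi * r ^ 2) *
                HC lamB (lamF / N) zeta ratio beta delta R))) /
          (1 - Real.exp (-(zeta * (lamB * Real.pi * r ^ 2) * (1 / R ^ 2 - 1))))) +
        (1 - zeta) * Real.exp (-(zeta * (lamB * Real.pi * r ^ 2) *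
              HC lamB (lamF / N) zeta ratio beta delta 1)) := by
  have hA := measurableSet_annulus R r
  have hav := hnet.measurableSet_avoidEvent hA
  have hR2 : 0 ≤ 1 / R ^ 2 - 1 := by
    rw [sub_nonneg, le_div_iff₀ (by positivity)]; nlinarith
  have hvoid : P (avoidEvent x act (annulus R r))
      = ENNReal.ofReal (Real.exp (-(zeta * (lamB * Real.pi * r ^ 2) * (1 / R ^ 2 - 1)))) := by
    rw [hnet.measure_avoidEvent hlamB.le hA, volume_annulus hR hR1 hr,
      negExp_ofReal_mul_ofReal (by positivity) (by positivity)]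
    congr 2; ring
  have hjoint := hnet.measure_avoidEvent_inter_covered hlamB.le hlamF.le c hA
    (alpha := alpha) hratio hbeta hr
  -- An empty ring pushes the exclusion radius from `r` to `r / R`, hence `HC` at `R` instead of
  -- `1`.
  have hset : {p : Plane | r ≤ ‖p‖} \ annulus R r = {p : Plane | r / R < ‖p‖} := by
    have hrR : r ≤ r / R := by rw [le_div_iff₀ hR]; nlinarith
    ext p
    simp only [annulus, Set.mem_sdiff, Set.mem_ofPred_eq, not_and, not_le]
    exact ⟨fun h => h.2 h.1, fun h => ⟨hrR.trans h.le, fun _ => h⟩⟩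
  rw [hset, mul_add, negExp_add, ← hnet.measure_avoidEvent hlamB.le hA, hvoid, mul_assoc,
    negExp_macro_mul_negExp_femto hlamB (by positivity) hzeta halpha hdelta
    hbeta hratio hr hR, ← ENNReal.ofReal_mul (Real.exp_pos _).le] at hjoint
  have hcov := hnet.measureReal_covered hlamB hlamF hzeta c halpha hdelta hratio hbeta hr
  rw [edgeCoverageAt, hcov, ringEvent_eq_compl_avoidEvent]
  congr 2
  rw [measureReal_def, cond_apply hav.compl, ENNReal.toReal_mul, ENNReal.toReal_inv,
    ← measureReal_def, ← measureReal_def, probReal_compl_eq_one_sub hav]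
  -- Coverage with a nonempty ring is coverage minus coverage with an empty ring; both of these are
  -- known.
  have hsplit := measureReal_inter_add_sdiff (μ := P)
    (s := {ω | ENNReal.ofReal beta < sir alpha ratio x y act ch c h₀ h g r ω}) hav
  rw [Set.inter_comm, hcov, measureReal_def, hjoint,
    ENNReal.toReal_ofReal (by positivity), Set.sdiff_eq, Set.inter_comm] at hsplit
  rw [eq_sub_of_add_eq' hsplit, measureReal_def P (avoidEvent _ _ _), hvoid,
    ENNReal.toReal_ofReal (Real.exp_pos _).le]
  exact (div_eq_inv_mul _ _).symm

end Network

/-! ### Ordered distances in terms of point counts -/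

section Deterministic

variable {Ω : Type*} (x : ℕ → Ω → Plane)

lemma pointCount_eq_encard (B : Set Plane) (ω : Ω) :
    pointCount x B ω = ({i | x i ω ∈ B}.encard : ℝ≥0∞) := by
  rw [← ENNReal.tsum_set_one, tsum_subtype {i | x i ω ∈ B} fun _ => (1 : ℝ≥0∞), pointCount]
  rfl

lemma kthDist_set_nonempty (k : ℕ) (ω : Ω) :
    {ρ : ℝ | (k : ℕ∞) ≤ {i : ℕ | ‖x i ω‖ ≤ ρ}.encard}.Nonempty := by
  -- The sum of the first `k` norms bounds each of them.
  refine ⟨∑ i ∈ Finset.range k, ‖x i ω‖, ?_⟩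
  have hsub : ((Finset.range k : Finset ℕ) : Set ℕ) ⊆
      {i : ℕ | ‖x i ω‖ ≤ ∑ i ∈ Finset.range k, ‖x i ω‖} := fun i hi =>
    Finset.single_le_sum (f := fun i => ‖x i ω‖) (fun _ _ => norm_nonneg _) hi
  have h := Set.encard_le_encard hsub
  rwa [Set.encard_coe_eq_coe_finsetCard, Finset.card_range] at h

lemma nonneg_of_mem_kthDist_set {k : ℕ} (hk : k ≠ 0) {ω : Ω} {ρ : ℝ}
    (hρ : (k : ℕ∞) ≤ {i : ℕ | ‖x i ω‖ ≤ ρ}.encard) : 0 ≤ ρ := by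
  have : {i : ℕ | ‖x i ω‖ ≤ ρ}.Nonempty := by
    rw [← Set.encard_ne_zero]
    intro h
    rw [h] at hρ
    simp at hρ
    exact hk hρ
  obtain ⟨i, hi⟩ := this
  exact (norm_nonneg _).trans hi

lemma kthDist_nonneg {k : ℕ} (hk : k ≠ 0) (ω : Ω) : 0 ≤ kthDist x k ω :=
  Real.sInf_nonneg fun _ hρ => nonneg_of_mem_kthDist_set x hk hρ

/-- The infimum matches the open ball: among `k` points in the ball the largest norm is attained and
is `< ρ`. For `k = 0` the defining set would be all of `ℝ`, unbounded below. -/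
lemma kthDist_lt_iff {k : ℕ} (hk : k ≠ 0) (ω : Ω) (ρ : ℝ) :
    kthDist x k ω < ρ ↔ (k : ℝ≥0∞) ≤ pointCount x (Metric.ball 0 ρ) ω := by
  have hbdd : BddBelow {ρ : ℝ | (k : ℕ∞) ≤ {i : ℕ | ‖x i ω‖ ≤ ρ}.encard} :=
    ⟨0, fun _ hρ => nonneg_of_mem_kthDist_set x hk hρ⟩
  rw [kthDist, csInf_lt_iff hbdd (kthDist_set_nonempty x k ω), pointCount_eq_encard]
  have hcast : (k : ℝ≥0∞) ≤ ({i | x i ω ∈ Metric.ball 0 ρ}.encard : ℝ≥0∞) ↔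
      (k : ℕ∞) ≤ {i | x i ω ∈ Metric.ball 0 ρ}.encard := by
    rw [← ENat.toENNReal_coe, ENat.toENNReal_le]
  rw [hcast]
  constructor
  · rintro ⟨s, hs, hsρ⟩
    refine le_trans hs (Set.encard_le_encard fun i hi => ?_)
    simpa using lt_of_le_of_lt hi hsρ
  · intro h
    obtain ⟨t, ht, htk⟩ := Set.exists_subset_encard_eq h
    have htf : t.Finite := Set.finite_of_encard_eq_coe htk
    have htn : htf.toFinset.Nonempty := by
      rw [Set.Finite.toFinset_nonempty, ← Set.encard_ne_zero, htk]
      exact_mod_cast hk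
    obtain ⟨j, hj, hmax⟩ := Finset.exists_max_image htf.toFinset (fun i => ‖x i ω‖) htn
    refine ⟨‖x j ω‖, ?_, ?_⟩
    · rw [Set.mem_ofPred_eq, ← htk]
      exact Set.encard_le_encard fun i hi => hmax i (htf.mem_toFinset.2 hi)
    · simpa using ht (htf.mem_toFinset.1 hj)

lemma kthDist_one_le_two (ω : Ω) : kthDist x 1 ω ≤ kthDist x 2 ω := by
  refine le_of_forall_gt fun ρ hρ => ?_
  rw [kthDist_lt_iff x (by norm_num)] at hρ ⊢
  exact le_trans (by norm_num) hρ

end Deterministic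

/-! ### Joint law of the two smallest distances -/

section Law

variable {Ω : Type*} [MeasurableSpace Ω] {P : Measure Ω} {x : ℕ → Ω → Plane} {lam : ℝ}

lemma IsPoissonPP.measurable_kthDist (hx : IsPoissonPP P x lam) {k : ℕ} (hk : k ≠ 0) :
    Measurable (kthDist x k) := by
  refine measurable_of_Iio fun ρ => ?_
  have : kthDist x k ⁻¹' Set.Iio ρ = {ω | (k : ℝ≥0∞) ≤ pointCount x (Metric.ball 0 ρ) ω} := by
    ext ω
    exact kthDist_lt_iff x hk ω ρ
  rw [this]
  exact measurableSet_le measurable_const (hx.measurable_pointCount measurableSet_ball)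

lemma IsPoissonPP.measure_pointCount_eq (hx : IsPoissonPP P x lam) (hlam : 0 ≤ lam) {B : Set Plane}
    (hB : MeasurableSet B) {v : ℝ} (hv : 0 ≤ v) (hBv : volume B = ENNReal.ofReal v) (n : ℕ) :
    P {ω | pointCount x B ω = n}
      = ENNReal.ofReal (Real.exp (-(lam * v)) * (lam * v) ^ n / n.factorial) := by
  have h1 : P {ω | pointCount x B ω = n} = P.map (pointCount x B) {(n : ℝ≥0∞)} := by
    rw [Measure.map_apply (hx.measurable_pointCount hB) (measurableSet_singleton _)]
    rfl
  rw [h1, hx.poisson B hB (hBv ▸ ENNReal.ofReal_ne_top),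
    Measure.map_apply (by fun_prop) (measurableSet_singleton _)]
  have h2 : (fun m : ℕ => (m : ℝ≥0∞)) ⁻¹' {(n : ℝ≥0∞)} = {n} := by
    ext m
    simp
  rw [h2, poissonMeasure_singleton, hBv]
  simp [ENNReal.ofReal, Real.coe_toNNReal _ hlam, Real.coe_toNNReal _ hv]

lemma volume_ball_sdiff_ball {a b : ℝ} (ha : 0 ≤ a) (hab : a ≤ b) :
    volume (Metric.ball (0 : Plane) b \ Metric.ball 0 a)
      = ENNReal.ofReal (Real.pi * (b ^ 2 - a ^ 2)) := by
  rw [measure_sdiff (Metric.ball_subset_ball hab) measurableSet_ball.nullMeasurableSet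
    measure_ball_lt_top.ne, EuclideanSpace.volume_ball_fin_two, EuclideanSpace.volume_ball_fin_two,
    ← ENNReal.ofReal_pow ha, ← ENNReal.ofReal_pow (ha.trans hab),
    ← ENNReal.ofReal_mul (by positivity), ← ENNReal.ofReal_mul (by positivity),
    ← ENNReal.ofReal_sub _ (by positivity)]
  congr 1
  ring

omit [MeasurableSpace Ω] in
lemma pointCount_ball_add (x : ℕ → Ω → Plane) {a b : ℝ} (hab : a ≤ b) (ω : Ω) :
    pointCount x (Metric.ball 0 b) ω
      = pointCount x (Metric.ball 0 a) ω + pointCount x (Metric.ball 0 b \ Metric.ball 0 a) ω := by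
  simp only [pointCount]
  rw [← ENNReal.tsum_add]
  refine tsum_congr fun i => ?_
  have hsub := Metric.ball_subset_ball (x := (0 : Plane)) hab
  by_cases h1 : x i ω ∈ Metric.ball (0 : Plane) a
  · rw [Set.indicator_of_mem (hsub h1), Set.indicator_of_mem h1,
      Set.indicator_of_notMem (fun h => h.2 h1), add_zero]
  · rw [Set.indicator_of_notMem h1, zero_add]
    by_cases h2 : x i ω ∈ Metric.ball (0 : Plane) b
    · rw [Set.indicator_of_mem h2, Set.indicator_of_mem (Set.mem_sdiff_of_mem h2 h1)]
    · rw [Set.indicator_of_notMem h2, Set.indicator_of_notMem fun h => h2 h.1]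

omit [MeasurableSpace Ω] in
lemma natCast_or_top_pointCount (x : ℕ → Ω → Plane) (B : Set Plane) (ω : Ω) :
    pointCount x B ω = ∞ ∨ ∃ n : ℕ, pointCount x B ω = n := by
  rw [pointCount_eq_encard]
  rcases eq_or_ne {i | x i ω ∈ B}.encard ⊤ with h | h
  · left; simp [h]
  · right
    obtain ⟨n, hn⟩ := ENat.ne_top_iff_exists.1 h
    exact ⟨n, by rw [← hn]; simp⟩

/-- Joint survival function of the two smallest distances. -/
lemma IsPoissonPP.measure_kthDist_ge (hx : IsPoissonPP P x lam) (hlam : 0 ≤ lam) {a b : ℝ}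
    (ha : 0 ≤ a) (hab : a ≤ b) :
    P {ω | a ≤ kthDist x 1 ω ∧ b ≤ kthDist x 2 ω}
      = ENNReal.ofReal (Real.exp (-(lam * Real.pi * b ^ 2)) *
          (1 + lam * Real.pi * b ^ 2 - lam * Real.pi * a ^ 2)) := by
  set A := Metric.ball (0 : Plane) a
  set B := Metric.ball (0 : Plane) b \ Metric.ball 0 a
  have hA : MeasurableSet A := measurableSet_ball
  have hB : MeasurableSet B := measurableSet_ball.diff measurableSet_ball
  have hvA : volume A = ENNReal.ofReal (Real.pi * a ^ 2) := by
    rw [EuclideanSpace.volume_ball_fin_two, ← ENNReal.ofReal_pow ha, mul_comm,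
      ENNReal.ofReal_mul Real.pi_pos.le]
  have hvB := volume_ball_sdiff_ball ha hab
  have hv0 : 0 ≤ Real.pi * (b ^ 2 - a ^ 2) :=
    mul_nonneg Real.pi_pos.le (sub_nonneg.2 (pow_le_pow_left₀ ha hab 2))
  -- The event says that the inner ball is empty and the shell holds at most one point; these two
  -- conditions are independent.
  have hset : {ω | a ≤ kthDist x 1 ω ∧ b ≤ kthDist x 2 ω}
      = {ω | pointCount x A ω = (0 : ℕ)} ∩
        ({ω | pointCount x B ω = (0 : ℕ)} ∪ {ω | pointCount x B ω = (1 : ℕ)}) := by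
    ext ω
    simp only [Set.mem_ofPred_eq, Set.mem_inter_iff, Set.mem_union]
    rw [← not_lt, ← not_lt, kthDist_lt_iff x one_ne_zero, kthDist_lt_iff x two_ne_zero,
      pointCount_ball_add x hab, not_le, not_le]
    change pointCount x A ω < _ ∧ pointCount x A ω + pointCount x B ω < _ ↔ _
    rcases natCast_or_top_pointCount x A ω with h | ⟨n, h⟩
    · simp [h]
    · rcases natCast_or_top_pointCount x B ω with h' | ⟨m, h'⟩
      · simp [h']
      · rw [h, h']
        norm_cast
        omega
  have hind : IndepFun (pointCount x A) (pointCount x B) P := by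
    have := hx.indep 2 ![A, B] (fun j => by fin_cases j <;> simp [hA, hB]) (fun i j hij => by
      fin_cases i <;> fin_cases j <;> simp_all [Function.onFun, A, B, Set.disjoint_sdiff_right,
        Set.disjoint_sdiff_left])
    exact this.indepFun (i := 0) (j := 1) (by simp)
  have hprod := hind.measure_inter_preimage_eq_mul {((0 : ℕ) : ℝ≥0∞)}
    {((0 : ℕ) : ℝ≥0∞), ((1 : ℕ) : ℝ≥0∞)} (measurableSet_singleton _)
    ((measurableSet_singleton _).insert _)
  have hunion : P ({ω | pointCount x B ω = (0 : ℕ)} ∪ {ω | pointCount x B ω = (1 : ℕ)})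
      = ENNReal.ofReal (Real.exp (-(lam * (Real.pi * (b ^ 2 - a ^ 2)))) *
          (1 + lam * (Real.pi * (b ^ 2 - a ^ 2)))) := by
    have hd : Disjoint {ω | pointCount x B ω = (0 : ℕ)} {ω | pointCount x B ω = (1 : ℕ)} := by
      refine Set.disjoint_left.2 fun ω h1 h2 => ?_
      rw [Set.mem_ofPred_eq] at h1 h2
      rw [h1] at h2
      norm_num at h2
    have hm : MeasurableSet {ω | pointCount x B ω = (1 : ℕ)} :=
      (hx.measurable_pointCount hB) (measurableSet_singleton _)
    rw [measure_union hd hm,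
      hx.measure_pointCount_eq hlam hB hv0 hvB, hx.measure_pointCount_eq hlam hB hv0 hvB,
      ← ENNReal.ofReal_add (by positivity) (by positivity)]
    congr 1
    simp
    ring
  rw [hset]
  change P (pointCount x A ⁻¹' {((0 : ℕ) : ℝ≥0∞)} ∩
    pointCount x B ⁻¹' {((0 : ℕ) : ℝ≥0∞), ((1 : ℕ) : ℝ≥0∞)}) = _
  rw [hprod]
  change P {ω | pointCount x A ω = (0 : ℕ)} *
    P ({ω | pointCount x B ω = (0 : ℕ)} ∪ {ω | pointCount x B ω = (1 : ℕ)}) = _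
  rw [hunion, hx.measure_pointCount_eq hlam hA (by positivity) hvA,
    ← ENNReal.ofReal_mul (by positivity)]
  congr 1
  simp only [pow_zero, Nat.factorial_zero, Nat.cast_one, div_one, mul_one]
  rw [← mul_assoc, ← Real.exp_add]
  congr 1
  · congr 1; ring
  · ring

end Law

lemma lintegral_exp_neg_Ioi (c : ℝ) :
    ∫⁻ v in Set.Ioi c, ENNReal.ofReal (Real.exp (-v)) = ENNReal.ofReal (Real.exp (-c)) := by
  rw [← ofReal_integral_eq_lintegral_ofReal
    (by simpa [IntegrableOn] using exp_neg_integrableOn_Ioi c one_pos)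
    (ae_of_all _ fun t => (Real.exp_pos _).le), integral_exp_neg_Ioi]

lemma lintegral_exp_neg_Ioc {a b : ℝ} (hab : a ≤ b) :
    ∫⁻ v in Set.Ioc a b, ENNReal.ofReal (Real.exp (-v))
      = ENNReal.ofReal (Real.exp (-a) - Real.exp (-b)) := by
  rw [ENNReal.ofReal_sub _ (Real.exp_pos _).le]
  refine ENNReal.eq_sub_of_add_eq ENNReal.ofReal_ne_top ?_
  rw [← lintegral_exp_neg_Ioi b, ← lintegral_exp_neg_Ioi a, ← Set.Ioc_union_Ioi_eq_Ioi hab,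
    lintegral_union measurableSet_Ioi (Set.Ioc_disjoint_Ioi le_rfl)]

/-- The law of the first two points of a unit-rate Poisson process on `(0, ∞)`. -/
noncomputable def firstTwoPointsLaw : Measure (ℝ × ℝ) :=
  (volume.prod volume).withDensity
    ({z | 0 < z.1 ∧ z.1 < z.2}.indicator fun z => ENNReal.ofReal (Real.exp (-z.2)))

lemma firstTwoPointsLaw_apply {S : Set (ℝ × ℝ)} (hS : MeasurableSet S) :
    firstTwoPointsLaw S
      = ∫⁻ u in Set.Ioi 0, ∫⁻ v in Set.Ioi u ∩ Prod.mk u ⁻¹' S, ENNReal.ofReal (Real.exp (-v)) := by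
  have hD : MeasurableSet {z : ℝ × ℝ | 0 < z.1 ∧ z.1 < z.2} :=
    (measurableSet_lt measurable_const measurable_fst).inter
      (measurableSet_lt measurable_fst measurable_snd)
  have hf : Measurable (({z : ℝ × ℝ | 0 < z.1 ∧ z.1 < z.2} ∩ S).indicator
      fun z => ENNReal.ofReal (Real.exp (-z.2))) :=
    Measurable.indicator (by fun_prop) (hD.inter hS)
  rw [firstTwoPointsLaw, withDensity_apply _ hS, ← lintegral_indicator hS,
    Set.indicator_indicator, Set.inter_comm, lintegral_prod _ hf.aemeasurable,
    ← lintegral_indicator measurableSet_Ioi]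
  refine lintegral_congr fun u => ?_
  by_cases hu : 0 < u
  · rw [Set.indicator_of_mem (Set.mem_Ioi.2 hu),
      ← lintegral_indicator (measurableSet_Ioi.inter (measurable_prodMk_left hS))]
    refine lintegral_congr fun v => ?_
    have hiff : (u, v) ∈ {z : ℝ × ℝ | 0 < z.1 ∧ z.1 < z.2} ∩ S ↔
        v ∈ Set.Ioi u ∩ Prod.mk u ⁻¹' S := by
      simp [hu]
    by_cases h : v ∈ Set.Ioi u ∩ Prod.mk u ⁻¹' S
    · rw [Set.indicator_of_mem h, Set.indicator_of_mem (hiff.2 h)]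
    · rw [Set.indicator_of_notMem h, Set.indicator_of_notMem (mt hiff.1 h)]
  · rw [Set.indicator_of_notMem (by simpa using hu)]
    simp [hu]

/-- The maxima replace arbitrary thresholds by effective ones `0 ≤ s' ≤ t'`. For `u` in `(s', t']`
the inner integral is `exp (-t')`, and beyond `t'` it is `exp (-u)`, which adds up to `exp (-t') (t'
- s' + 1)`. -/
lemma firstTwoPointsLaw_Ici_prod_Ici (s t : ℝ) :
    firstTwoPointsLaw (Set.Ici s ×ˢ Set.Ici t)
      = ENNReal.ofReal (Real.exp (-(max t (max s 0))) * (1 + max t (max s 0) - max s 0)) := by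
  set s' := max s 0 with hs'
  set t' := max t s' with ht'
  have hst : s' ≤ t' := le_max_right _ _
  have h1 : ∀ u ∈ Set.Ioi (0 : ℝ), ∫⁻ v in Set.Ioi u ∩ Prod.mk u ⁻¹' (Set.Ici s ×ˢ Set.Ici t),
      ENNReal.ofReal (Real.exp (-v))
        = (Set.Ici s).indicator (fun u => ENNReal.ofReal (Real.exp (-(max t u)))) u := by
    intro u _
    by_cases hu : s ≤ u
    · have : Prod.mk u ⁻¹' (Set.Ici s ×ˢ Set.Ici t) = Set.Ici t := by ext v; simp [hu]
      have hae : (Set.Ioi u ∩ Set.Ici t : Set ℝ) =ᵐ[volume] Set.Ioi (max t u) := by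
        rw [max_comm, ← Set.Ioi_inter_Ioi]
        exact (ae_eq_refl _).inter Ioi_ae_eq_Ici.symm
      rw [this, Measure.restrict_congr_set hae, lintegral_exp_neg_Ioi,
        Set.indicator_of_mem (Set.mem_Ici.2 hu)]
    · have : Prod.mk u ⁻¹' (Set.Ici s ×ˢ Set.Ici t) = ∅ := by ext v; simp [hu]
      rw [this, Set.indicator_of_notMem (by simpa using hu)]
      simp
  have hae : (Set.Ici s ∩ Set.Ioi 0 : Set ℝ) =ᵐ[volume] Set.Ioi s' := by
    rw [hs', ← Set.Ioi_inter_Ioi]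
    exact Ioi_ae_eq_Ici.symm.inter (ae_eq_refl _)
  have hmeas : MeasurableSet (Set.Ici s ×ˢ Set.Ici t) := measurableSet_Ici.prod measurableSet_Ici
  rw [firstTwoPointsLaw_apply hmeas, setLIntegral_congr_fun measurableSet_Ioi h1,
    lintegral_indicator measurableSet_Ici, Measure.restrict_restrict measurableSet_Ici,
    Measure.restrict_congr_set hae, ← Set.Ioc_union_Ioi_eq_Ioi hst,
    lintegral_union measurableSet_Ioi (Set.Ioc_disjoint_Ioi le_rfl),
    setLIntegral_congr_fun (g := fun _ => ENNReal.ofReal (Real.exp (-t'))) measurableSet_Ioc,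
    setLIntegral_congr_fun (s := Set.Ioi t') (g := fun u => ENNReal.ofReal (Real.exp (-u)))
      measurableSet_Ioi, lintegral_exp_neg_Ioi, setLIntegral_const, Real.volume_Ioc,
    ← ENNReal.ofReal_mul (Real.exp_pos _).le,
    ← ENNReal.ofReal_add (mul_nonneg (Real.exp_pos _).le (by linarith)) (Real.exp_pos _).le]
  · congr 1; ring
  · intro u hu
    have : t ≤ u := (le_max_left _ _).trans (le_of_lt hu)
    simp only [max_eq_right this]
  · intro u hu
    have h2 : max t u = t' := by
      refine le_antisymm (max_le (le_max_left _ _) hu.2) (max_le (le_max_left _ _) ?_)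
      exact hu.1.le.trans (le_max_right _ _)
    simp only [h2]

section Law

variable {Ω : Type*} [MeasurableSpace Ω] {P : Measure Ω} {x : ℕ → Ω → Plane} {lam : ℝ}

/-- The mean number of points in the disc reaching to the `k`-th closest point. -/
noncomputable def scaledArea (lam : ℝ) (x : ℕ → Ω → Plane) (k : ℕ) (ω : Ω) : ℝ :=
  lam * Real.pi * kthDist x k ω ^ 2

lemma IsPoissonPP.measurable_scaledArea (hx : IsPoissonPP P x lam) {k : ℕ} (hk : k ≠ 0) :
    Measurable (scaledArea lam x k) :=
  ((hx.measurable_kthDist hk).pow_const 2).const_mul _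

omit [MeasurableSpace Ω] in
lemma le_scaledArea_iff (hlam : 0 < lam) (x : ℕ → Ω → Plane) {k : ℕ} (hk : k ≠ 0) (ω : Ω)
    (s : ℝ) : s ≤ scaledArea lam x k ω ↔ √(s / (lam * Real.pi)) ≤ kthDist x k ω := by
  rw [Real.sqrt_le_left (kthDist_nonneg x hk ω), div_le_iff₀ (by positivity), scaledArea, mul_comm]

/-- The area scale maps the planar radii to a unit-rate process on the half-line. Both measures
agree on the π-system of quadrants, by the joint survival function. -/
lemma IsPoissonPP.map_scaledArea [IsProbabilityMeasure P] (hx : IsPoissonPP P x lam)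
    (hlam : 0 < lam) :
    P.map (fun ω => (scaledArea lam x 1 ω, scaledArea lam x 2 ω)) = firstTwoPointsLaw := by
  have hm : Measurable fun ω => (scaledArea lam x 1 ω, scaledArea lam x 2 ω) :=
    (hx.measurable_scaledArea one_ne_zero).prodMk (hx.measurable_scaledArea two_ne_zero)
  have hprob := Measure.isProbabilityMeasure_map (μ := P) hm.aemeasurable
  have hspan : IsCountablySpanning (Set.range (Set.Ici : ℝ → Set ℝ)) := by
    refine ⟨fun n : ℕ => Set.Ici (-(n : ℝ)), fun n => ⟨_, rfl⟩, ?_⟩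
    refine Set.eq_univ_of_forall fun t => Set.mem_iUnion.2 ?_
    obtain ⟨n, hn⟩ := exists_nat_ge (-t)
    exact ⟨n, by simp only [Set.mem_Ici]; linarith⟩
  have hgen : MeasurableSpace.generateFrom (Set.range (Set.Ici : ℝ → Set ℝ))
      = (inferInstance : MeasurableSpace ℝ) :=
    (borel_eq_generateFrom_Ici ℝ).symm.trans BorelSpace.measurable_eq.symm
  refine Measure.ext_of_generateFrom_of_iUnion
    (Set.image2 (· ×ˢ ·) (Set.range Set.Ici) (Set.range Set.Ici))
    (fun n : ℕ => Set.Ici (-(n : ℝ)) ×ˢ Set.Ici (-(n : ℝ)))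
    (generateFrom_eq_prod hgen hgen hspan hspan).symm
    (isPiSystem_Ici.prod isPiSystem_Ici) ?_ (fun n => ⟨_, ⟨_, rfl⟩, _, ⟨_, rfl⟩, rfl⟩)
    (fun n => measure_ne_top _ _) ?_
  · refine Set.eq_univ_of_forall fun z => Set.mem_iUnion.2 ?_
    obtain ⟨n, hn⟩ := exists_nat_ge (max (-z.1) (-z.2))
    have h1 := (le_max_left _ _).trans hn
    have h2 := (le_max_right _ _).trans hn
    exact ⟨n, by simp only [Set.mem_Ici]; linarith, by simp only [Set.mem_Ici]; linarith⟩
  · rintro _ ⟨_, ⟨s, rfl⟩, _, ⟨t, rfl⟩, rfl⟩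
    have hmeas : MeasurableSet (Set.Ici s ×ˢ Set.Ici t) := measurableSet_Ici.prod measurableSet_Ici
    rw [firstTwoPointsLaw_Ici_prod_Ici, Measure.map_apply hm hmeas]
    set s' := max s 0 with hs'
    set t' := max t s' with ht'
    have hs0 : 0 ≤ s' := le_max_right _ _
    have hst : s' ≤ t' := le_max_right _ _
    have hc : 0 < lam * Real.pi := by positivity
    have key := hx.measure_kthDist_ge hlam.le (Real.sqrt_nonneg (s' / (lam * Real.pi)))
      (Real.sqrt_le_sqrt ((div_le_div_iff_of_pos_right hc).2 hst))
    rw [Real.sq_sqrt (div_nonneg hs0 hc.le), Real.sq_sqrt (div_nonneg (hs0.trans hst) hc.le),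
      mul_div_cancel₀ _ hc.ne', mul_div_cancel₀ _ hc.ne'] at key
    rw [← key]
    congr 1
    ext ω
    simp only [Set.mem_preimage, Set.mem_prod, Set.mem_Ici, Set.mem_ofPred_eq]
    -- Passing to the effective thresholds does not change the event, because `0 ≤ scaledArea lam x
    -- 1 ω ≤ scaledArea lam x 2 ω`.
    rw [← le_scaledArea_iff hlam x one_ne_zero ω s',
      ← le_scaledArea_iff hlam x two_ne_zero ω t']
    have h0 : 0 ≤ scaledArea lam x 1 ω := by unfold scaledArea; positivity
    have h12 : scaledArea lam x 1 ω ≤ scaledArea lam x 2 ω := by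
      unfold scaledArea
      have := kthDist_one_le_two x ω
      have := kthDist_nonneg x one_ne_zero ω
      gcongr
    constructor
    · rintro ⟨h1, h2⟩
      exact ⟨max_le h1 h0, max_le h2 ((max_le h1 h0).trans h12)⟩
    · rintro ⟨h1, h2⟩
      exact ⟨(le_max_left _ _).trans h1, (le_max_left _ _).trans h2⟩

omit [MeasurableSpace Ω] in
lemma mem_edgeEvent_iff (hlam : 0 < lam) (x : ℕ → Ω → Plane) {R : ℝ} (hR : 0 < R) (ω : Ω) :
    ω ∈ edgeEvent x R ↔ R ^ 2 * scaledArea lam x 2 ω < scaledArea lam x 1 ω := by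
  have h1 := kthDist_nonneg x one_ne_zero ω
  have h12 := kthDist_one_le_two x ω
  have hc : 0 < lam * Real.pi := by positivity
  rw [edgeEvent, Set.mem_ofPred_eq, scaledArea, scaledArea, mul_left_comm,
    mul_lt_mul_iff_right₀ hc, ← mul_pow]
  -- If the second distance is zero, the ratio is zero by convention and both sides are false.
  rcases (h1.trans h12).eq_or_lt with h2 | h2
  · have : kthDist x 1 ω = 0 := le_antisymm (h12.trans h2.symm.le) h1
    simp [← h2, this, hR.le]
  · rw [lt_div_iff₀ h2, pow_lt_pow_iff_left₀ (by positivity) h1 two_ne_zero]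

/-- The law of the serving distance on the event that the user is a cell-edge user. -/
lemma IsPoissonPP.map_restrict_edgeEvent [IsProbabilityMeasure P] (hx : IsPoissonPP P x lam)
    (hlam : 0 < lam) {R : ℝ} (hR : 0 < R) (hR1 : R < 1) :
    (P.restrict (edgeEvent x R)).map (scaledArea lam x 1)
      = (volume.restrict (Set.Ioi 0)).withDensity
          fun u => ENNReal.ofReal (Real.exp (-u) - Real.exp (-(u / R ^ 2))) := by
  have hm1 := hx.measurable_scaledArea one_ne_zero
  have hm : Measurable fun ω => (scaledArea lam x 1 ω, scaledArea lam x 2 ω) :=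
    hm1.prodMk (hx.measurable_scaledArea two_ne_zero)
  refine Measure.ext fun S hS => ?_
  have hT : MeasurableSet {z : ℝ × ℝ | z.1 ∈ S ∧ R ^ 2 * z.2 < z.1} :=
    (measurable_fst hS).inter (measurableSet_lt (by fun_prop) measurable_fst)
  have h1 : scaledArea lam x 1 ⁻¹' S ∩ edgeEvent x R
      = (fun ω => (scaledArea lam x 1 ω, scaledArea lam x 2 ω)) ⁻¹'
        {z : ℝ × ℝ | z.1 ∈ S ∧ R ^ 2 * z.2 < z.1} := by
    ext ω
    rw [Set.mem_inter_iff, mem_edgeEvent_iff hlam x hR]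
    rfl
  rw [Measure.map_apply hm1 hS, Measure.restrict_apply (hm1 hS), h1, ← Measure.map_apply hm hT,
    hx.map_scaledArea hlam, firstTwoPointsLaw_apply hT, withDensity_apply _ hS,
    ← lintegral_indicator hS]
  refine setLIntegral_congr_fun measurableSet_Ioi fun u (hu : 0 < u) => ?_
  by_cases huS : u ∈ S
  · have hle : u ≤ u / R ^ 2 := by
      rw [le_div_iff₀ (by positivity)]
      nlinarith [pow_lt_one₀ hR.le hR1 two_ne_zero]
    -- Given the first point `u`, the second must lie in `(u, u / R ^ 2)`; integrating `exp (-v)`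
    -- there produces the density.
    have hset : Set.Ioi u ∩ Prod.mk u ⁻¹' {z : ℝ × ℝ | z.1 ∈ S ∧ R ^ 2 * z.2 < z.1}
        = Set.Ioo u (u / R ^ 2) := by
      ext v
      simp only [Set.mem_inter_iff, Set.mem_Ioi, Set.mem_preimage, Set.mem_ofPred_eq, huS,
        true_and, Set.mem_Ioo, lt_div_iff₀ (show 0 < R ^ 2 by positivity), mul_comm]
    rw [hset, Set.indicator_of_mem huS, Measure.restrict_congr_set Ioo_ae_eq_Ioc,
      lintegral_exp_neg_Ioc hle]
  · have hset : Prod.mk u ⁻¹' {z : ℝ × ℝ | z.1 ∈ S ∧ R ^ 2 * z.2 < z.1} = ∅ := by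
      ext v
      simp [huS]
    rw [hset, Set.indicator_of_notMem huS]
    simp

end Law

/-! ### Laplace transform of the serving-area density and the geometric series -/

section Series

/-- The unnormalised density of the scaled serving area of a cell-edge user. -/
noncomputable def edgeDensity (R u : ℝ) : ℝ := Real.exp (-u) - Real.exp (-(u / R ^ 2))

/-- The Laplace transform of `edgeDensity`. -/
noncomputable def edgeLaplace (R s : ℝ) : ℝ := 1 / (1 + s) - 1 / (1 / R ^ 2 + s)

lemma one_lt_one_div_sq {R : ℝ} (hR : 0 < R) (hR1 : R < 1) : 1 < 1 / R ^ 2 := by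
  rw [lt_div_iff₀ (by positivity), one_mul]
  exact pow_lt_one₀ hR.le hR1 two_ne_zero

lemma edgeDensity_nonneg {R u : ℝ} (hR : 0 < R) (hR1 : R < 1) (hu : 0 ≤ u) :
    0 ≤ edgeDensity R u := by
  have := one_lt_one_div_sq hR hR1
  rw [edgeDensity, sub_nonneg, Real.exp_le_exp, neg_le_neg_iff, div_eq_mul_one_div]
  nlinarith

lemma integrableOn_exp_neg_mul {b : ℝ} (hb : 0 < b) :
    IntegrableOn (fun u : ℝ => Real.exp (-(b * u))) (Set.Ioi 0) := by
  simpa using exp_neg_integrableOn_Ioi 0 hb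

lemma integral_exp_neg_mul {b : ℝ} (hb : 0 < b) :
    ∫ u in Set.Ioi (0 : ℝ), Real.exp (-(b * u)) = 1 / b := by
  have := integral_exp_mul_Ioi (a := -b) (by linarith) 0
  simpa using this

lemma edgeDensity_mul_exp (R s u : ℝ) : edgeDensity R u * Real.exp (-(s * u))
    = Real.exp (-((1 + s) * u)) - Real.exp (-((1 / R ^ 2 + s) * u)) := by
  rw [edgeDensity, sub_mul, ← Real.exp_add, ← Real.exp_add]
  congr 2 <;> ring

lemma integrableOn_edgeDensity_mul_exp {R s : ℝ} (hR : 0 < R) (hs : 0 ≤ s) :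
    IntegrableOn (fun u => edgeDensity R u * Real.exp (-(s * u))) (Set.Ioi 0) := by
  simp_rw [edgeDensity_mul_exp]
  exact (integrableOn_exp_neg_mul (by positivity)).sub (integrableOn_exp_neg_mul (by positivity))

lemma integral_edgeDensity_mul_exp {R s : ℝ} (hR : 0 < R) (hs : 0 ≤ s) :
    ∫ u in Set.Ioi (0 : ℝ), edgeDensity R u * Real.exp (-(s * u)) = edgeLaplace R s := by
  simp_rw [edgeDensity_mul_exp]
  rw [integral_sub (integrableOn_exp_neg_mul (by positivity))
    (integrableOn_exp_neg_mul (by positivity)), integral_exp_neg_mul (by positivity),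
    integral_exp_neg_mul (by positivity), edgeLaplace]

/-- The product form makes positivity and monotonicity in `s` visible. -/
lemma edgeLaplace_eq {R s : ℝ} (hR : 0 < R) (hs : 0 ≤ s) :
    edgeLaplace R s = (1 / R ^ 2 - 1) / ((1 + s) * (1 / R ^ 2 + s)) := by
  have h1 : 0 < 1 / R ^ 2 + s := by positivity
  rw [edgeLaplace, div_sub_div _ _ (by positivity) h1.ne']
  congr 1
  ring

lemma edgeLaplace_nonneg {R s : ℝ} (hR : 0 < R) (hR1 : R < 1) (hs : 0 ≤ s) :
    0 ≤ edgeLaplace R s := by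
  rw [edgeLaplace_eq hR hs]
  exact div_nonneg (sub_nonneg.2 (one_lt_one_div_sq hR hR1).le) (by positivity)

lemma edgeLaplace_antitone {R s t : ℝ} (hR : 0 < R) (hR1 : R < 1) (hs : 0 ≤ s) (hst : s ≤ t) :
    edgeLaplace R t ≤ edgeLaplace R s := by
  rw [edgeLaplace_eq hR hs, edgeLaplace_eq hR (hs.trans hst)]
  have ht : 0 ≤ t := hs.trans hst
  have := sub_nonneg.2 (one_lt_one_div_sq hR hR1).le
  gcongr

variable {R a b k : ℝ}

/-- Geometric expansion of the conditional coverage probability, averaged over the serving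
distance. -/
lemma hasSum_edgeLaplace_sub (hR : 0 < R) (hR1 : R < 1) (hb : 0 ≤ b) (hba : b ≤ a) (hk : 0 < k)
    (hab : a ≤ b + k) :
    HasSum (fun n : ℕ => edgeLaplace R (a + n * k) - edgeLaplace R (b + (n + 1) * k))
      (∫ u in Set.Ioi (0 : ℝ), edgeDensity R u *
        ((Real.exp (-(a * u)) - Real.exp (-(k * u)) * Real.exp (-(b * u))) /
          (1 - Real.exp (-(k * u))))) := by
  have ha : 0 ≤ a := hb.trans hba
  have hs1 : ∀ n : ℕ, 0 ≤ a + n * k := fun n => by positivity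
  have hs2 : ∀ n : ℕ, 0 ≤ b + (n + 1) * k := fun n => by positivity
  -- This is where `a ≤ b + k` enters: it makes every term `F n` nonnegative.
  have hle : ∀ n : ℕ, a + n * k ≤ b + (n + 1) * k := fun n => by linarith
  set F : ℕ → ℝ → ℝ := fun n u => edgeDensity R u * Real.exp (-((a + n * k) * u)) -
    edgeDensity R u * Real.exp (-((b + (n + 1) * k) * u)) with hF
  have hFint : ∀ n, IntegrableOn (F n) (Set.Ioi 0) := fun n =>
    (integrableOn_edgeDensity_mul_exp hR (hs1 n)).sub (integrableOn_edgeDensity_mul_exp hR (hs2 n))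
  have hFval : ∀ n, ∫ u in Set.Ioi (0 : ℝ), F n u
      = edgeLaplace R (a + n * k) - edgeLaplace R (b + (n + 1) * k) := fun n => by
    rw [hF, integral_sub (integrableOn_edgeDensity_mul_exp hR (hs1 n))
      (integrableOn_edgeDensity_mul_exp hR (hs2 n)), integral_edgeDensity_mul_exp hR (hs1 n),
      integral_edgeDensity_mul_exp hR (hs2 n)]
  have hFnn : ∀ n, ∀ u ∈ Set.Ioi (0 : ℝ), 0 ≤ F n u := by
    intro n u hu
    have hu' : 0 < u := hu
    rw [hF]
    refine sub_nonneg.2 (mul_le_mul_of_nonneg_left ?_ (edgeDensity_nonneg hR hR1 hu'.le))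
    rw [Real.exp_le_exp, neg_le_neg_iff]
    exact mul_le_mul_of_nonneg_right (hle n) hu'.le
  have hnorm : ∀ n, ∫ u in Set.Ioi (0 : ℝ), ‖F n u‖
      = edgeLaplace R (a + n * k) - edgeLaplace R (b + (n + 1) * k) := fun n => by
    rw [← hFval n]
    exact setIntegral_congr_fun measurableSet_Ioi fun u hu => Real.norm_of_nonneg (hFnn n u hu)
  have hsum : Summable fun n : ℕ => ∫ u in Set.Ioi (0 : ℝ), ‖F n u‖ := by
    refine summable_of_sum_range_le (c := edgeLaplace R a) (fun n => by positivity) fun n => ?_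
    simp_rw [hnorm]
    -- Replacing `b` by the larger `a` in the subtracted term only increases the difference and
    -- makes the sum telescope.
    calc ∑ i ∈ Finset.range n, (edgeLaplace R (a + i * k) - edgeLaplace R (b + (i + 1) * k))
        ≤ ∑ i ∈ Finset.range n, (edgeLaplace R (a + (i : ℕ) * k) -
            edgeLaplace R (a + (i + 1 : ℕ) * k)) := by
          refine Finset.sum_le_sum fun i _ => sub_le_sub_left ?_ _
          refine edgeLaplace_antitone hR hR1 (hs2 i) ?_
          push_cast
          linarith
      _ = edgeLaplace R a - edgeLaplace R (a + n * k) := by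
          rw [Finset.sum_range_sub' fun i : ℕ => edgeLaplace R (a + i * k)]
          simp
      _ ≤ edgeLaplace R a := sub_le_self _ (edgeLaplace_nonneg hR hR1 (hs1 n))
  have key := hasSum_integral_of_summable_integral_norm (μ := volume.restrict (Set.Ioi 0)) (F := F)
    hFint hsum
  simp_rw [hFval] at key
  have hgeom : ∀ u ∈ Set.Ioi (0 : ℝ), edgeDensity R u *
      ((Real.exp (-(a * u)) - Real.exp (-(k * u)) * Real.exp (-(b * u))) /
        (1 - Real.exp (-(k * u)))) = ∑' n, F n u := by
    intro u hu
    have hu' : 0 < u := hu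
    have hq1 : Real.exp (-(k * u)) < 1 := Real.exp_lt_one_iff.2 (by nlinarith)
    have hgeo := (hasSum_geometric_of_lt_one (Real.exp_pos _).le hq1).mul_left
      (edgeDensity R u * (Real.exp (-(a * u)) - Real.exp (-(k * u)) * Real.exp (-(b * u))))
    have hterm : (fun n : ℕ => edgeDensity R u * (Real.exp (-(a * u)) -
        Real.exp (-(k * u)) * Real.exp (-(b * u))) * Real.exp (-(k * u)) ^ n) = fun n => F n u := by
      funext n
      rw [hF]
      simp only
      rw [← Real.exp_nat_mul, ← Real.exp_add, mul_assoc, sub_mul, ← Real.exp_add, ← Real.exp_add,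
        mul_sub]
      congr 3 <;> ring
    rw [hterm] at hgeo
    rw [hgeo.tsum_eq, mul_div_assoc', div_eq_mul_inv]
  rw [setIntegral_congr_fun measurableSet_Ioi hgeom]
  exact key

/-- The quotient lies in `[0, 1]`: with `q = exp (-k u)`, its numerator is at most `exp (-b u) (1 -
q) ≤ 1 - q`, and it is nonnegative by `a ≤ b + k`. Hence `edgeDensity` dominates. -/
lemma integrableOn_edgeDensity_mul_conditional (hR : 0 < R) (hR1 : R < 1) (hb : 0 ≤ b) (hba : b ≤ a)
    (hk : 0 < k) (hab : a ≤ b + k) :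
    IntegrableOn (fun u => edgeDensity R u *
        ((Real.exp (-(a * u)) - Real.exp (-(k * u)) * Real.exp (-(b * u))) /
          (1 - Real.exp (-(k * u))))) (Set.Ioi 0) := by
  have hint : IntegrableOn (edgeDensity R) (Set.Ioi 0) := by
    simpa using integrableOn_edgeDensity_mul_exp hR le_rfl
  refine Integrable.mono' hint (Measurable.aestronglyMeasurable (by unfold edgeDensity; fun_prop))
    (ae_restrict_of_forall_mem measurableSet_Ioi fun u (hu : 0 < u) => ?_)
  have hw := edgeDensity_nonneg hR hR1 hu.le
  have hq1 : Real.exp (-(k * u)) < 1 := Real.exp_lt_one_iff.2 (by nlinarith)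
  have hq0 := Real.exp_pos (-(k * u))
  have h1 : Real.exp (-(k * u)) * Real.exp (-(b * u)) ≤ Real.exp (-(a * u)) := by
    rw [← Real.exp_add, Real.exp_le_exp]
    nlinarith
  have h2 : Real.exp (-(a * u)) ≤ Real.exp (-(b * u)) := by
    rw [Real.exp_le_exp]
    nlinarith
  have h3 : Real.exp (-(b * u)) ≤ 1 := Real.exp_le_one_iff.2 (by nlinarith)
  rw [norm_mul, Real.norm_of_nonneg hw,
    Real.norm_of_nonneg (div_nonneg (sub_nonneg.2 h1) (sub_nonneg.2 hq1.le))]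
  refine mul_le_of_le_one_right hw ((div_le_one (sub_pos.2 hq1)).2 ?_)
  nlinarith

end Series

/-! ### Bounds on the interference exponents -/

section HC

variable {lamB lamFc zeta ratio beta delta : ℝ}

lemma HC_nonneg (hlamB : 0 < lamB) (hlamFc : 0 ≤ lamFc) (hzeta : 0 < zeta) (hratio : 0 < ratio)
    (hbeta : 0 < beta) (hd0 : 0 < delta) (hd1 : delta < 1) {rho : ℝ} :
    0 ≤ HC lamB lamFc zeta ratio beta delta rho := by
  have hsin : 0 < Real.sin (Real.pi * delta) :=
    Real.sin_pos_of_pos_of_lt_pi (by positivity) (by nlinarith [Real.pi_pos])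
  have := Real.rpow_nonneg hbeta.le delta
  have hI := setIntegral_one_div_one_add_rpow_nonneg
    (c := 1 / (rho ^ 2 * beta ^ delta)) (by positivity) (1 / delta)
  unfold HC
  positivity

/-- The FAP contributions cancel, leaving `beta ^ delta` times the integral over `(c₁, c₂]` of a
function with values in `[0, 1]`, and `beta ^ delta * (c₂ - c₁) = 1 / R ^ 2 - 1`. These bounds are
what the geometric expansion requires of its parameters. -/
lemma GC_bounds (hbeta : 0 < beta) (hd0 : 0 < delta) (hd1 : delta < 1) {R : ℝ} (hR : 0 < R)
    (hR1 : R < 1) :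
    0 ≤ GC lamB lamFc zeta ratio beta delta R ∧
      GC lamB lamFc zeta ratio beta delta R ≤ 1 / R ^ 2 - 1 := by
  have hbd : 0 < beta ^ delta := Real.rpow_pos_of_pos hbeta _
  set c₁ := 1 / (1 ^ 2 * beta ^ delta) with hc₁
  set c₂ := 1 / (R ^ 2 * beta ^ delta) with hc₂
  have h1 : 0 ≤ c₁ := by positivity
  have h12 : c₁ ≤ c₂ := by
    rw [hc₁, hc₂]
    gcongr
  have hint := integrableOn_one_div_one_add_rpow hd0 hd1
  have hsplit : ∫ v in Set.Ioi c₁, 1 / (1 + v ^ (1 / delta))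
      = (∫ v in Set.Ioc c₁ c₂, 1 / (1 + v ^ (1 / delta))) +
        ∫ v in Set.Ioi c₂, 1 / (1 + v ^ (1 / delta)) := by
    rw [← Set.Ioc_union_Ioi_eq_Ioi h12, setIntegral_union (Set.Ioc_disjoint_Ioi le_rfl)
      measurableSet_Ioi (hint.mono_set fun v hv => h1.trans_lt hv.1)
      (hint.mono_set (Set.Ioi_subset_Ioi (h1.trans h12)))]
  have hG : GC lamB lamFc zeta ratio beta delta R
      = beta ^ delta * ∫ v in Set.Ioc c₁ c₂, 1 / (1 + v ^ (1 / delta)) := by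
    rw [GC, HC, HC, ← hc₁, ← hc₂, hsplit]
    ring
  rw [hG]
  constructor
  · refine mul_nonneg hbd.le (setIntegral_nonneg measurableSet_Ioc fun v hv => ?_)
    exact one_div_one_add_rpow_nonneg (h1.trans hv.1.le) _
  · have hle : ∫ v in Set.Ioc c₁ c₂, 1 / (1 + v ^ (1 / delta)) ≤ c₂ - c₁ := by
      calc ∫ v in Set.Ioc c₁ c₂, 1 / (1 + v ^ (1 / delta)) ≤ ∫ _ in Set.Ioc c₁ c₂, (1 : ℝ) := by
            refine setIntegral_mono_on (hint.mono_set fun v hv => h1.trans_lt hv.1)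
              (by simp) measurableSet_Ioc fun v hv => ?_
            have := Real.rpow_nonneg (h1.trans hv.1.le) (1 / delta)
            rw [div_le_one (by positivity)]
            linarith
        _ = c₂ - c₁ := by simp [h12]
    refine (mul_le_mul_of_nonneg_left hle hbd.le).trans_eq ?_
    rw [hc₁, hc₂]
    field_simp

end HC

/-! ### Averaging over the serving distance and matching the series -/

section Network

variable {Ω : Type*} [MeasurableSpace Ω] {P : Measure Ω} [IsProbabilityMeasure P]
  {x : ℕ → Ω → Plane} {lam R : ℝ}

/-- The total mass of the restricted law is the Laplace transform at zero, `edgeLaplace R 0 = 1 - R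
^ 2`. -/
lemma IsPoissonPP.measure_edgeEvent (hx : IsPoissonPP P x lam) (hlam : 0 < lam) (hR : 0 < R)
    (hR1 : R < 1) : P (edgeEvent x R) = ENNReal.ofReal (1 - R ^ 2) := by
  have hm := hx.measurable_scaledArea one_ne_zero
  have h := congrArg (fun μ : Measure ℝ => μ Set.univ) (hx.map_restrict_edgeEvent hlam hR hR1)
  rw [Measure.map_apply hm MeasurableSet.univ, Set.preimage_univ, Measure.restrict_apply_univ,
    withDensity_apply _ MeasurableSet.univ, Measure.restrict_univ] at h
  have hint := integrableOn_edgeDensity_mul_exp hR le_rfl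
  have hval := integral_edgeDensity_mul_exp hR le_rfl
  simp only [zero_mul, neg_zero, Real.exp_zero, mul_one] at hint hval
  rw [h]
  change ∫⁻ u in Set.Ioi 0, ENNReal.ofReal (edgeDensity R u) = _
  rw [← ofReal_integral_eq_lintegral_ofReal hint (ae_restrict_of_forall_mem measurableSet_Ioi
    fun u (hu : 0 < u) => edgeDensity_nonneg hR hR1 hu.le), hval, edgeLaplace]
  congr 1
  field_simp
  ring

/-- Averages over the serving distance of a cell-edge user. -/
lemma IsPoissonPP.integral_map_cond_edgeEvent (hx : IsPoissonPP P x lam) (hlam : 0 < lam)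
    (hR : 0 < R) (hR1 : R < 1) {f Φ : ℝ → ℝ} (hΦ : Measurable Φ)
    (hf : ∀ r, 0 < r → f r = Φ (lam * Real.pi * r ^ 2)) :
    ∫ r, f r ∂((ProbabilityTheory.cond P (edgeEvent x R)).map (kthDist x 1))
      = (1 - R ^ 2)⁻¹ * ∫ u in Set.Ioi (0 : ℝ), edgeDensity R u * Φ u := by
  have hD := hx.measurable_kthDist one_ne_zero
  have hm := hx.measurable_scaledArea one_ne_zero
  have hlaw := hx.map_restrict_edgeEvent hlam hR hR1
  have hpos : ∀ᵐ ω ∂(P.restrict (edgeEvent x R)), 0 < scaledArea lam x 1 ω := by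
    refine ae_of_ae_map hm.aemeasurable ?_
    rw [hlaw]
    exact (withDensity_absolutelyContinuous _ _).ae_le (ae_restrict_mem measurableSet_Ioi)
  -- The serving distance is almost surely positive, so the values of `f` at `r ≤ 0` play no role.
  have hpos' : ∀ᵐ ω ∂(ProbabilityTheory.cond P (edgeEvent x R)), 0 < kthDist x 1 ω := by
    refine Measure.ae_smul_measure ?_ _
    filter_upwards [hpos] with ω hω
    refine lt_of_le_of_ne (kthDist_nonneg x one_ne_zero ω) fun h => ?_
    simp [scaledArea, ← h] at hω
  have hΦm : Measurable fun r : ℝ => Φ (lam * Real.pi * r ^ 2) := hΦ.comp (by fun_prop)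
  have hae : f =ᵐ[(ProbabilityTheory.cond P (edgeEvent x R)).map (kthDist x 1)]
      fun r => Φ (lam * Real.pi * r ^ 2) := by
    have : ∀ᵐ r ∂((ProbabilityTheory.cond P (edgeEvent x R)).map (kthDist x 1)), 0 < r :=
      (ae_map_iff hD.aemeasurable measurableSet_Ioi).2 hpos'
    filter_upwards [this] with r hr using hf r hr
  have hw : Measurable fun u : ℝ => ENNReal.ofReal (Real.exp (-u) - Real.exp (-(u / R ^ 2))) := by
    fun_prop
  rw [integral_congr_ae hae, integral_map hD.aemeasurable hΦm.aestronglyMeasurable,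
    ProbabilityTheory.cond, integral_smul_measure, hx.measure_edgeEvent hlam hR hR1]
  change _ • ∫ ω, Φ (scaledArea lam x 1 ω) ∂(P.restrict (edgeEvent x R)) = _
  rw [← integral_map (f := Φ) hm.aemeasurable hΦ.aestronglyMeasurable, hlaw,
    integral_withDensity_eq_integral_toReal_smul hw (ae_of_all _ fun _ => ENNReal.ofReal_lt_top),
    ENNReal.toReal_inv, ENNReal.toReal_ofReal (by nlinarith), smul_eq_mul]
  congr 1
  refine setIntegral_congr_fun measurableSet_Ioi fun u (hu : 0 < u) => ?_
  have := edgeDensity_nonneg hR hR1 hu.le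
  rw [edgeDensity] at this
  simp only [smul_eq_mul]
  rw [ENNReal.toReal_ofReal this, edgeDensity]

end Network

/-- Each of the four denominators has a factor `R ^ 2`. The index `l` then selects which of the two
fractions of `edgeLaplace` appears, and `k` selects its argument: `H + G` with shift `n`, or `H`
with shift `n + 1`. -/
lemma seriesTerm_eq {zeta R H G : ℝ} (hR : 0 < R) (n : ℕ) :
    seriesTerm zeta R H G n = (R ^ 2)⁻¹ *
      (edgeLaplace R (zeta * (H + G) + n * (zeta * (1 / R ^ 2 - 1))) -
        edgeLaplace R (zeta * H + (n + 1) * (zeta * (1 / R ^ 2 - 1)))) := by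
  have hR2 : (R ^ 2) ≠ 0 := by positivity
  simp only [seriesTerm, edgeLaplace, Finset.sum_range_succ, Finset.sum_range_zero]
  have e1 : (n : ℝ) * zeta * (1 - R ^ 2) + 1 * zeta * R ^ 2 * G + zeta * R ^ 2 * H + 1
      = R ^ 2 * (1 / R ^ 2 + (zeta * (H + G) + n * (zeta * (1 / R ^ 2 - 1)))) := by
    field_simp; ring
  have e2 : ((n : ℝ) + 1) * zeta * (1 - R ^ 2) + 0 * zeta * R ^ 2 * G + zeta * R ^ 2 * H + 1
      = R ^ 2 * (1 / R ^ 2 + (zeta * H + (n + 1) * (zeta * (1 / R ^ 2 - 1)))) := by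
    field_simp; ring
  have e3 : (n : ℝ) * zeta * (1 - R ^ 2) + 1 * zeta * R ^ 2 * G + zeta * R ^ 2 * H + R ^ 2
      = R ^ 2 * (1 + (zeta * (H + G) + n * (zeta * (1 / R ^ 2 - 1)))) := by
    field_simp; ring
  have e4 : ((n : ℝ) + 1) * zeta * (1 - R ^ 2) + 0 * zeta * R ^ 2 * G + zeta * R ^ 2 * H + R ^ 2
      = R ^ 2 * (1 + (zeta * H + (n + 1) * (zeta * (1 / R ^ 2 - 1)))) := by
    field_simp; ring
  norm_num only [Nat.cast_zero, Nat.cast_one, add_zero, zero_add, mul_zero, pow_zero, mul_one,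
    abs_neg, abs_one, abs_zero, zero_sub, sub_self]
  norm_num at e1 e2 e3 e4 ⊢
  rw [e1, e2, e3, e4]
  simp only [mul_inv, div_eq_mul_inv]
  ring

end CoChannel

/-! ### Assembly of the coverage formula -/

theorem corollary2 {Ω : Type*} [MeasurableSpace Ω] (P : MeasureTheory.Measure Ω)
    [MeasureTheory.IsProbabilityMeasure P]
    (lamB lamF powB powF alpha zetaC R beta : ℝ) (N : ℕ)
    (x y : ℕ → Ω → CoChannel.Plane) (act : ℕ → Ω → Bool) (ch : ℕ → Ω → Fin N) (c : Fin N)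
    (h₀ : Ω → ℝ) (h g : ℕ → Ω → ℝ)
    (hlamB : 0 < lamB) (hlamF : 0 < lamF) (hpowB : 0 < powB) (hpowF : 0 < powF)
    (halpha : 2 < alpha) (hzeta : 0 < zetaC) (hzeta1 : zetaC ≤ 1) (hR : 0 < R) (hR1 : R < 1)
    (hbeta : 0 < beta)
    (hnet : CoChannel.IsNetwork P lamB lamF zetaC N x y act ch h₀ h g)
    (delta : ℝ) (hdelta : delta = 2 / alpha)
    (H : ℝ → ℝ) (hH : H = CoChannel.HC lamB (lamF / N) zetaC (powF / powB) beta delta)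
    (G : ℝ) (hG : G = CoChannel.GC lamB (lamF / N) zetaC (powF / powB) beta delta R) :
    Summable (CoChannel.seriesTerm zetaC R (H R) G) ∧
    CoChannel.edgeCoverage P alpha (powF / powB) zetaC R x y act ch c h₀ h g beta =
      (1 - zetaC) / (1 - R ^ 2) *
          ∑ l ∈ Finset.range 2, (-(R ^ 2)) ^ l / (1 + R ^ (2 * l) * zetaC * H 1) +
        zetaC * R ^ 2 / (1 - R ^ 2) * ∑' n : ℕ, CoChannel.seriesTerm zetaC R (H R) G n := by
  open CoChannel in
  have hd0 : 0 < delta := by rw [hdelta]; positivity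
  have hd1 : delta < 1 := by rw [hdelta, div_lt_one (by linarith)]; exact halpha
  have hratio : 0 < powF / powB := by positivity
  have hlamFc : 0 ≤ lamF / N := by positivity
  have hH1 : 0 ≤ H 1 := hH ▸ HC_nonneg hlamB hlamFc hzeta hratio hbeta hd0 hd1
  have hHR : 0 ≤ H R := hH ▸ HC_nonneg hlamB hlamFc hzeta hratio hbeta hd0 hd1
  obtain ⟨hG0, hG1⟩ : 0 ≤ G ∧ G ≤ 1 / R ^ 2 - 1 := hG ▸ GC_bounds hbeta hd0 hd1 hR hR1
  have hHG : H 1 = H R + G := by rw [hG, GC, ← hH]; ring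
  have hR2 : R ^ 2 < 1 := pow_lt_one₀ hR.le hR1 two_ne_zero
  have hd : 0 < 1 / R ^ 2 - 1 := sub_pos.2 (one_lt_one_div_sq hR hR1)
  set k := zetaC * (1 / R ^ 2 - 1) with hk
  have hk0 : 0 < k := mul_pos hzeta hd
  -- With these parameters `b ≤ a ≤ b + k` is exactly `0 ≤ G ≤ 1 / R ^ 2 - 1` multiplied by `zetaC`.
  have hsum := hasSum_edgeLaplace_sub (a := zetaC * H 1) (b := zetaC * H R) (k := k) hR hR1
    (by positivity) (by rw [hHG]; nlinarith) hk0 (by rw [hHG, hk]; nlinarith)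
  have hseries : HasSum (seriesTerm zetaC R (H R) G) ((R ^ 2)⁻¹ *
      ∫ u in Set.Ioi (0 : ℝ), edgeDensity R u *
        ((Real.exp (-(zetaC * H 1 * u)) - Real.exp (-(k * u)) * Real.exp (-(zetaC * H R * u))) /
          (1 - Real.exp (-(k * u))))) := by
    rw [show seriesTerm zetaC R (H R) G = _ from funext fun n => seriesTerm_eq hR n, ← hHG]
    exact hsum.mul_left _
  refine ⟨hseries.summable, ?_⟩
  rw [hseries.tsum_eq]
  set C : ℝ → ℝ := fun u => (Real.exp (-(zetaC * H 1 * u)) -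
    Real.exp (-(k * u)) * Real.exp (-(zetaC * H R * u))) / (1 - Real.exp (-(k * u))) with hC
  -- Mixture over whether the second closest MBS is co-channel, as a function of the scaled area
  -- alone.
  set Φ : ℝ → ℝ := fun u => zetaC * C u + (1 - zetaC) * Real.exp (-(zetaC * H 1 * u)) with hΦ
  have hΦm : Measurable Φ := by rw [hΦ, hC]; fun_prop
  have hcov : edgeCoverage P alpha (powF / powB) zetaC R x y act ch c h₀ h g beta
      = (1 - R ^ 2)⁻¹ * ∫ u in Set.Ioi (0 : ℝ), edgeDensity R u * Φ u := by
    refine hnet.mbs.integral_map_cond_edgeEvent hlamB hR hR1 hΦm fun r hr => ?_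
    rw [hnet.edgeCoverageAt_eq hlamB hlamF hzeta c halpha hdelta hratio hbeta hR hR1 hr, ← hH]
    simp only [hΦ, hC, hk]
    simp only [mul_right_comm zetaC]
  have hb0 : 0 ≤ zetaC * H R := by positivity
  have hba : zetaC * H R ≤ zetaC * H 1 := by rw [hHG]; nlinarith
  have hab : zetaC * H 1 ≤ zetaC * H R + k := by rw [hHG, hk]; nlinarith
  have hsplit : ∫ u in Set.Ioi (0 : ℝ), edgeDensity R u * Φ u
      = zetaC * (∫ u in Set.Ioi (0 : ℝ), edgeDensity R u * C u) +
        (1 - zetaC) * edgeLaplace R (zetaC * H 1) := by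
    rw [← integral_edgeDensity_mul_exp hR (hb0.trans hba), ← integral_const_mul,
      ← integral_const_mul, ← integral_add
        ((integrableOn_edgeDensity_mul_conditional hR hR1 hb0 hba hk0 hab).const_mul _)
        ((integrableOn_edgeDensity_mul_exp hR (hb0.trans hba)).const_mul _)]
    refine setIntegral_congr_fun measurableSet_Ioi fun u _ => ?_
    simp only [hΦ, hC]
    ring
  -- The unconditioned part is a single Laplace transform, whose second fraction is `R ^ 2 / (1 + R
  -- ^ 2 * s)` at `s = zetaC * H 1`.
  have hfirst : ∑ l ∈ Finset.range 2, (-(R ^ 2)) ^ l / (1 + R ^ (2 * l) * zetaC * H 1)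
      = edgeLaplace R (zetaC * H 1) := by
    have h1 : 1 / R ^ 2 + zetaC * H 1 = (1 + R ^ 2 * zetaC * H 1) / R ^ 2 := by
      field_simp
    rw [edgeLaplace, h1, one_div_div]
    simp [Finset.sum_range_succ]
    ring
  rw [hcov, hsplit, hfirst]
  change _ = _ + zetaC * R ^ 2 / (1 - R ^ 2) *
    ((R ^ 2)⁻¹ * ∫ u in Set.Ioi (0 : ℝ), edgeDensity R u * C u)
  generalize (∫ u in Set.Ioi (0 : ℝ), edgeDensity R u * C u) = I
  have h1R : 1 - R ^ 2 ≠ 0 := (sub_pos.2 hR2).ne'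
  field_simp
  ring
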